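/- **Notation.** Let $q$ be a complex number with $|q|<1$. For $a,p\in\mathbb C$ and $n\ge 0$ put $(a;p)_n=\prod_{i=0}^{n-1}(1-ap^i)$ and $(a_1,\dots,a_j;p)_n=(a_1;p)_n\cdots(a_j;p)_n$. Let $\psi(q)=\sum_{n=0}^{\infty}q^{n(n+1)/2}$ be Ramanujan's theta function. A pair of sequences $(\alpha_n,\beta_n)_{n\ge0}$ is a *Bailey pair with respect to $a$ with base $p$* if $\alpha_0=\beta_0=1$ and, for $n>0$, $$\beta_n=\sum_{j=0}^{n}\frac{\alpha_j}{(p;p)_{n-j}(ap;p)_{n+j}} .$$ An infinite series is understood as the limit of its partial sums; that all series below converge (in (iii): that the two $\beta$-series converge) is part of the assertion. **Corollary.** (i) $$q\frac{\psi^3(q^3)}{\psi(q)}=\sum_{n=1}^{\infty}\frac{(1-q^{6n-2})(-q^3;q^3)_{n-1}q^{(3n^2-n)/2}}{(1-q^{3n-2})(1-q^{3n})(-q;q^3)_n}-\sum_{n=1}^{\infty}\frac{(1-q^{6n-1})(-q^3;q^3)_{n-1}q^{(3n^2+n)/2}}{(1-q^{3n-1})(1-q^{3n})(-q^2;q^3)_n}.$$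 (ii) $$q\frac{\psi^3(q^3)}{\psi(q)}=\sum_{n=1}^{\infty}\frac{(-q^3;q^3)_{n-1}(-1)^nq^{2n}}{(1-q^{3n})(q^2;q^3)_n}-\sum_{n=1}^{\infty}\frac{(-q^3;q^3)_{n-1}(-1)^nq^{n}}{(1-q^{3n})(q;q^3)_n}.$$ Suppose from now on that $q\neq0$. (iii) Let $\alpha_n(a,p),\beta_n(a,p)$ be families of sequences, depending on a free parameter $a$ and on the base $p$, such that $(\alpha_n(a,p),\beta_n(a,p))$ is a Bailey pair with respect to $a$ with base $p$ for $(a,p)=(1/q,q^3)$ and for $(a,p)=(1/q^2,q^3)$. If the two series below that contain $\alpha_n$ converge, then so do the two that contain $\beta_n$, and $$q\frac{\psi^3(q^3)}{\psi(q)}=\sum_{n=1}^{\infty}(q^6;q^6)_{n-1}(-q^2)^n\beta_n(1/q,q^3)-\sum_{n=1}^{\infty}(q^6;q^6)_{n-1}(-q)^n\beta_n(1/q^2,q^3)$$ $$\qquad+\sum_{n=1}^{\infty}\frac{(q^6;q^6)_{n-1}(-q)^n}{(q^2;q^6)_n}\alpha_n(1/q^2,q^3)-\sum_{n=1}^{\infty}\frac{(q^6;q^6)_{n-1}(-q^2)^n}{(q^4;q^6)_n}\alpha_n(1/q,q^3).$$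 (iv) Let $d\in\mathbb C$, $d\neq0$, with $d\neq q^{3n+1}$ and $d\neq q^{3n+2}$ for all integers $n\ge0$. Then $$q\frac{\psi^3(q^3)}{\psi(q)}=\sum_{n=1}^{\infty}\frac{(q^6;q^6)_{n-1}(q^2/d;q^6)_n(-q^2)^n}{(q^2;q^6)_n(q^2/d,q^3;q^3)_n}-\sum_{n=1}^{\infty}\frac{(q^6;q^6)_{n-1}(q/d;q^6)_n(-q)^n}{(q;q^6)_n(q/d,q^3;q^3)_n}$$ $$\qquad+\sum_{n=1}^{\infty}\frac{(1-q^{12n-2})(q^6;q^6)_{2n-1}(1/q^2,d;q^6)_nq^{6n^2}}{(1-1/q^2)(q^2;q^6)_{2n}(q^4/d,q^6;q^6)_nd^n}-\sum_{n=1}^{\infty}\frac{(1-q^{12n-1})(q^6;q^6)_{2n-1}(1/q,d;q^6)_nq^{6n^2+3n}}{(1-1/q)(q^4;q^6)_{2n}(q^5/d,q^6;q^6)_nd^n}.$$ (v) $$q\frac{\psi^3(q^3)}{\psi(q)}=\sum_{n=1}^{\infty}\frac{(q^6;q^6)_{n-1}(-q^2)^n}{(q^2;q^6)_n(q^3;q^3)_n}-\sum_{n=1}^{\infty}\frac{(q^6;q^6)_{n-1}(-q)^n}{(q;q^6)_n(q^3;q^3)_n}$$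 $$\qquad+\sum_{n=1}^{\infty}\frac{(1-q^{12n-2})(q^6;q^6)_{2n-1}(1/q^2;q^6)_n(-1)^nq^{9n^2-3n}}{(1-1/q^2)(q^2;q^6)_{2n}(q^6;q^6)_n}-\sum_{n=1}^{\infty}\frac{(1-q^{12n-1})(q^6;q^6)_{2n-1}(1/q;q^6)_n(-1)^nq^{9n^2}}{(1-1/q)(q^4;q^6)_{2n}(q^6;q^6)_n}.$$ -/

import Mathlib

open Filter Topology

/-- The finite `q`-shifted factorial `(a; q)_n = (1 - a) (1 - a q) ⋯ (1 - a q ^ (n - 1))`. -/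
noncomputable def qPoch (a q : ℂ) (n : ℕ) : ℂ :=
  ∏ i ∈ Finset.range n, (1 - a * q ^ i)

/-- Ramanujan's theta function `ψ(q) = ∑_{n ≥ 0} q ^ (n (n + 1) / 2)`. -/
noncomputable def ramanujanPsi (q : ℂ) : ℂ :=
  ∑' n : ℕ, q ^ (n * (n + 1) / 2)

/-- `(α_n, β_n)` is a Bailey pair with respect to `a`, with base `q`. -/
structure IsBaileyPair (a q : ℂ) (α β : ℕ → ℂ) : Prop where
  alpha_zero : α 0 = 1
  beta_zero : β 0 = 1
  beta_eq : ∀ n : ℕ, 0 < n → β n =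
    ∑ j ∈ Finset.range (n + 1), α j / (qPoch q q (n - j) * qPoch (a * q) q (n + j))

/-- The series `∑_{n ≥ 1} u n` converges, with sum `s`: its partial sums
`u 1 + ⋯ + u N` tend to `s`. -/
def SeriesSum (u : ℕ → ℂ) (s : ℂ) : Prop :=
  Tendsto (fun N : ℕ => ∑ n ∈ Finset.Icc 1 N, u n) atTop (𝓝 s)

/-!
Put `p = q ^ 3`. All the sums are reduced to the two Lambert series
`∑_{k ≥ 0} c p ^ k / (1 - c ^ 2 p ^ (2 k))` with `c = q` and `c = q ^ 2`, whose difference is the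
bilateral sum `∑_{k ∈ ℤ} q p ^ k / (1 - q ^ 2 p ^ (2 k))` split at `k = 0`. Shifting the summation
index of the `q`-Gauss sum by `N` and letting `N → ∞` evaluates this bilateral sum as an infinite
product (Kronecker), and the Jacobi triple product identifies that product with
`q ψ(q ^ 3) ^ 3 / ψ(q)`.

The series in (i) and (ii) satisfy, in the variable `c`, a first-order functional equation under
`c ↦ c p` whose inhomogeneous term is `± c / (1 - c ^ 2)`; iterating it yields the Lambert series.

For (iii), insert the definition of `β_n` and interchange the summations. By the `q`-Gauss sum each
`α_j` with `j ≥ 1` then contributes exactly its term of the `α`-series, while `α_0` contributes the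
series of (ii). The exchange is legitimate for a merely convergent `α`-series because the weights
decay geometrically, uniformly in `j`.

Both (iv) and (v) apply (iii) to a Bailey pair with `α_{2 j + 1} = 0` and a free parameter
`e = 1 / d`; (v), the limit `d → ∞`, is the case `e = 0`.
-/

/-- The infinite `q`-shifted factorial `(a; q)_∞`, the value of the product
`∏_{i ≥ 0} (1 - a q ^ i)`, which converges for `‖q‖ < 1`. -/
noncomputable def qPochInf (a q : ℂ) : ℂ :=
  ∏' i : ℕ, (1 - a * q ^ i)

section ShiftedFactorial

theorem qPoch_zero (a q : ℂ) : qPoch a q 0 = 1 := Finset.prod_range_zero _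

theorem qPoch_succ (a q : ℂ) (n : ℕ) :
    qPoch a q (n + 1) = qPoch a q n * (1 - a * q ^ n) :=
  Finset.prod_range_succ _ n

theorem qPoch_one (a q : ℂ) : qPoch a q 1 = 1 - a := by
  simp [qPoch]

theorem qPoch_add (a q : ℂ) (m n : ℕ) :
    qPoch a q (m + n) = qPoch a q m * qPoch (a * q ^ m) q n := by
  simp only [qPoch, Finset.prod_range_add, pow_add, mul_assoc]

theorem qPoch_succ' (a q : ℂ) (n : ℕ) :
    qPoch a q (n + 1) = (1 - a) * qPoch (a * q) q n := by
  rw [add_comm, qPoch_add, qPoch_one, pow_one]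

theorem qPoch_mul_qPoch_neg (a q : ℂ) (n : ℕ) :
    qPoch a q n * qPoch (-a) q n = qPoch (a ^ 2) (q ^ 2) n := by
  simp only [qPoch, ← Finset.prod_mul_distrib]
  exact Finset.prod_congr rfl fun i _ => by ring

theorem qPoch_mul_eq_prod (a q : ℂ) (k n : ℕ) :
    qPoch a q (k * n) = ∏ j ∈ Finset.range k, qPoch (a * q ^ j) (q ^ k) n := by
  induction n with
  | zero => simp [qPoch_zero]
  | succ n ih =>
    simp only [qPoch_succ, Finset.prod_mul_distrib, ← ih]
    rw [mul_add_one, qPoch_add, qPoch]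
    exact congrArg _ (Finset.prod_congr rfl fun j _ => by ring)

theorem qPoch_div_pow {u q : ℂ} (hu : u ≠ 0) (hq : q ≠ 0) (n : ℕ) :
    qPoch (u / q ^ n) q n = (-u) ^ n / q ^ ((n + 1).choose 2) * qPoch (q / u) q n := by
  induction n with
  | zero => simp [qPoch_zero]
  | succ n ih =>
    have shift : u / q ^ (n + 1) * q = u / q ^ n := by
      rw [pow_succ, ← div_div, div_mul_cancel₀ _ hq]
    rw [qPoch_succ', shift, ih, qPoch_succ, Nat.choose_succ_succ' (n + 1), Nat.choose_one_right]
    field_simp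
    ring

theorem one_sub_ne_zero_of_norm_lt_one {x : ℂ} (h : ‖x‖ < 1) : 1 - x ≠ 0 :=
  (isUnit_one_sub_of_norm_lt_one h).ne_zero

theorem norm_mul_pow_le {q : ℂ} (hq : ‖q‖ ≤ 1) (a : ℂ) (n : ℕ) : ‖a * q ^ n‖ ≤ ‖a‖ := by
  rw [norm_mul, norm_pow]
  exact mul_le_of_le_one_right (norm_nonneg a) (pow_le_one₀ (norm_nonneg q) hq)

theorem mul_pow_ne_one {a q : ℂ} (ha : ‖a‖ < 1) (hq : ‖q‖ ≤ 1) (n : ℕ) : a * q ^ n ≠ 1 :=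
  fun h => absurd ((norm_mul_pow_le hq a n).trans_lt ha) (by simp [h])

theorem norm_pow_succ_lt_one {q : ℂ} (hq : ‖q‖ < 1) (n : ℕ) : ‖q ^ (n + 1)‖ < 1 := by
  rw [norm_pow]
  exact pow_lt_one₀ (norm_nonneg q) hq n.succ_ne_zero

theorem qPoch_ne_zero {a q : ℂ} (h : ∀ k : ℕ, a * q ^ k ≠ 1) (n : ℕ) : qPoch a q n ≠ 0 :=
  Finset.prod_ne_zero_iff.mpr fun i _ => sub_ne_zero.mpr (h i).symm

theorem qPoch_self_ne_zero {q : ℂ} (hq : ‖q‖ < 1) (n : ℕ) : qPoch q q n ≠ 0 :=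
  qPoch_ne_zero (mul_pow_ne_one hq hq.le) n

variable {a q : ℂ}

theorem summable_norm_mul_pow (hq : ‖q‖ < 1) (a : ℂ) : Summable fun i : ℕ => ‖-(a * q ^ i)‖ := by
  simpa [norm_mul] using (summable_geometric_of_lt_one (norm_nonneg q) hq).mul_left ‖a‖

theorem tendsto_qPoch (hq : ‖q‖ < 1) (a : ℂ) :
    Tendsto (qPoch a q) atTop (𝓝 (qPochInf a q)) := by
  have := (multipliable_one_add_of_summable (summable_norm_mul_pow hq a)).tendsto_prod_tprod_nat
  simp only [← sub_eq_add_neg] at this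
  exact this

theorem qPochInf_ne_zero (hq : ‖q‖ < 1) (h : ∀ k : ℕ, a * q ^ k ≠ 1) : qPochInf a q ≠ 0 := by
  have := tprod_one_add_ne_zero_of_summable (f := fun i : ℕ => -(a * q ^ i))
    (fun i => by simpa only [← sub_eq_add_neg] using sub_ne_zero.mpr (h i).symm)
    (summable_norm_mul_pow hq a)
  simp only [← sub_eq_add_neg] at this
  exact this

theorem qPoch_mul_qPochInf (hq : ‖q‖ < 1) (a : ℂ) (n : ℕ) :
    qPoch a q n * qPochInf (a * q ^ n) q = qPochInf a q := by
  refine tendsto_nhds_unique ((tendsto_qPoch hq _).const_mul _) ?_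
  simpa only [← qPoch_add, Function.comp_def, add_comm n] using
    (tendsto_qPoch hq a).comp (tendsto_add_atTop_nat n)

theorem qPochInf_mul_qPochInf_neg (hq : ‖q‖ < 1) (a : ℂ) :
    qPochInf a q * qPochInf (-a) q = qPochInf (a ^ 2) (q ^ 2) := by
  refine tendsto_nhds_unique ((tendsto_qPoch hq a).mul (tendsto_qPoch hq (-a))) ?_
  simpa only [qPoch_mul_qPoch_neg] using tendsto_qPoch (norm_pow_succ_lt_one hq 1) (a ^ 2)

theorem qPochInf_eq_prod (hq : ‖q‖ < 1) (a : ℂ) {k : ℕ} (hk : k ≠ 0) :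
    qPochInf a q = ∏ j ∈ Finset.range k, qPochInf (a * q ^ j) (q ^ k) := by
  have hqk : ‖q ^ k‖ < 1 := by
    rw [norm_pow]
    exact pow_lt_one₀ (norm_nonneg q) hq hk
  refine tendsto_nhds_unique
    ((tendsto_qPoch hq a).comp (tendsto_id.const_mul_atTop' hk.bot_lt)) ?_
  simpa only [Function.comp_def, id, qPoch_mul_eq_prod] using
    tendsto_finsetProd (Finset.range k) fun j _ => tendsto_qPoch hqk (a * q ^ j)

theorem norm_qPoch_le {r : ℝ} (ha : ‖a‖ ≤ r) (hq : ‖q‖ < 1) (n : ℕ) :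
    ‖qPoch a q n‖ ≤ Real.exp (r / (1 - ‖q‖)) := by
  have factor_le : ∀ i, ‖1 - a * q ^ i‖ ≤ Real.exp (r * ‖q‖ ^ i) := fun i =>
    calc ‖1 - a * q ^ i‖ ≤ 1 + ‖a‖ * ‖q‖ ^ i := by simpa using norm_sub_le 1 (a * q ^ i)
      _ ≤ r * ‖q‖ ^ i + 1 := by rw [add_comm]; gcongr
      _ ≤ _ := Real.add_one_le_exp _
  calc ‖qPoch a q n‖ ≤ ∏ i ∈ Finset.range n, Real.exp (r * ‖q‖ ^ i) := by
        rw [qPoch, norm_prod]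
        exact Finset.prod_le_prod (fun _ _ => norm_nonneg _) fun i _ => factor_le i
    _ = Real.exp (r * ∑ i ∈ Finset.range n, ‖q‖ ^ i) := by rw [← Real.exp_sum, Finset.mul_sum]
    _ ≤ Real.exp (r / (1 - ‖q‖)) := by
        rw [div_eq_mul_inv, ← tsum_geometric_of_lt_one (norm_nonneg q) hq]
        have hr : 0 ≤ r := (norm_nonneg a).trans ha
        gcongr
        exact (summable_geometric_of_lt_one (norm_nonneg q) hq).sum_le_tsum _
          fun i _ => by positivity

theorem exists_norm_inv_qPoch_le (hq : ‖q‖ < 1) (h : ∀ k : ℕ, a * q ^ k ≠ 1) :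
    ∃ C : ℝ, ∀ n, ‖(qPoch a q n)⁻¹‖ ≤ C := by
  obtain ⟨C, hC⟩ := (((tendsto_qPoch hq a).inv₀ (qPochInf_ne_zero hq h)).norm).bddAbove_range
  exact ⟨C, fun n => hC ⟨n, rfl⟩⟩

theorem exists_norm_inv_qPoch_mul_pow_le (hq : ‖q‖ < 1) (h : ∀ k : ℕ, a * q ^ k ≠ 1) :
    ∃ C : ℝ, ∀ k n, ‖(qPoch (a * q ^ k) q n)⁻¹‖ ≤ C := by
  obtain ⟨C, hC⟩ := exists_norm_inv_qPoch_le hq h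
  refine ⟨Real.exp (‖a‖ / (1 - ‖q‖)) * C, fun k n => ?_⟩
  have quotient : (qPoch (a * q ^ k) q n)⁻¹ = qPoch a q k * (qPoch a q (k + n))⁻¹ := by
    rw [qPoch_add, mul_inv, mul_inv_cancel_left₀ (qPoch_ne_zero h k)]
  rw [quotient, norm_mul]
  exact mul_le_mul (norm_qPoch_le le_rfl hq k) (hC _) (norm_nonneg _) (Real.exp_nonneg _)

end ShiftedFactorial

section SeriesTools

theorem tsum_eq_of_telescope {E : Type*} [AddCommGroup E] [TopologicalSpace E]
    [IsTopologicalAddGroup E] [T2Space E] {t s U : ℕ → E} (ht : Summable t) (hs : Summable s)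
    (h : ∀ n, t n = s n + (U n - U (n + 1))) (hU : Tendsto U atTop (𝓝 0)) :
    ∑' n, t n = U 0 + ∑' n, s n := by
  have partial_sum (N : ℕ) : ∑ n ∈ Finset.range N, (t n - s n) = U 0 - U N := by
    rw [← Finset.sum_range_sub']
    exact Finset.sum_congr rfl fun n _ => by rw [h n, add_sub_cancel_left]
  have limit : Tendsto (fun N => ∑ n ∈ Finset.range N, (t n - s n)) atTop (𝓝 (U 0)) := by
    simpa only [partial_sum, sub_zero] using hU.const_sub (U 0)
  rw [← sub_eq_iff_eq_add, ← ht.tsum_sub hs]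
  exact tendsto_nhds_unique (ht.sub hs).hasSum.tendsto_sum_nat limit

theorem summable_const_mul_norm_pow_succ {c : ℂ} (hc : ‖c‖ < 1) (C : ℝ) :
    Summable fun n : ℕ => C * ‖c‖ ^ (n + 1) :=
  ((summable_nat_add_iff 1).mpr (summable_geometric_of_lt_one (norm_nonneg c) hc)).mul_left C

theorem tendsto_tsum_zero_of_norm_le_mul_pow {E : Type*} [NormedAddCommGroup E]
    [CompleteSpace E] {t : ℕ → ℕ → E} {B : ℕ → ℝ} {c p : ℂ}
    (hp : ‖p‖ < 1) (hB : ∀ n, 0 ≤ B n) (hsum : Summable fun n => B n * ‖c‖ ^ (n + 1))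
    (h : ∀ k n, ‖t k n‖ ≤ B n * ‖c * p ^ k‖ ^ (n + 1)) :
    Tendsto (fun k => ∑' n, t k n) atTop (𝓝 0) := by
  have to_zero : Tendsto (fun k : ℕ => ‖c * p ^ k‖) atTop (𝓝 0) := by
    simpa using ((tendsto_pow_atTop_nhds_zero_of_norm_lt_one hp).const_mul c).norm
  rw [show (0 : E) = ∑' _ : ℕ, 0 from tsum_zero.symm]
  refine tendsto_tsum_of_dominated_convergence hsum
    (fun n => squeeze_zero_norm (h · n) ?_) (.of_forall fun k n => (h k n).trans ?_)
  · simpa using (to_zero.pow (n + 1)).const_mul (B n)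
  · have := hB n
    gcongr
    exact norm_mul_pow_le hp.le c k

theorem tendsto_sum_of_functional_eq {E : Type*} [AddCommGroup E] [TopologicalSpace E]
    [IsTopologicalAddGroup E] {f g : ℕ → E} (h : ∀ k, f k = g k + f (k + 1))
    (hf : Tendsto f atTop (𝓝 0)) :
    Tendsto (fun K => ∑ k ∈ Finset.range K, g k) atTop (𝓝 (f 0)) := by
  have partial_sum (K : ℕ) : ∑ k ∈ Finset.range K, g k = f 0 - f K := by
    rw [← Finset.sum_range_sub']
    exact Finset.sum_congr rfl fun k _ => by rw [h k, add_sub_cancel_right]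
  simpa only [partial_sum, sub_zero] using hf.const_sub (f 0)

end SeriesTools

/-- The term of index `n + 1` of the `q`-Gauss series
`∑ (a; p)_m (b; p)_m z ^ m / ((p; p)_m (abz; p)_m)`, divided by `1 - a`. Dropping the factor
`1 - a` keeps the series nontrivial at `a = 1`, where it becomes a Lambert series. -/
noncomputable def gaussTerm (a b p z : ℂ) (n : ℕ) : ℂ :=
  qPoch (a * p) p n * qPoch b p (n + 1) * z ^ (n + 1) /
    (qPoch p p (n + 1) * qPoch (a * b * z) p (n + 1))

section GaussSum

variable {a b p z : ℂ}

theorem one_sub_mul_gaussTerm (a b p z : ℂ) (n : ℕ) :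
    (1 - a) * gaussTerm a b p z n = qPoch a p (n + 1) * qPoch b p (n + 1) * z ^ (n + 1) /
      (qPoch p p (n + 1) * qPoch (a * b * z) p (n + 1)) := by
  rw [gaussTerm, qPoch_succ' a]
  ring

theorem gaussTerm_telescope (hp : ‖p‖ < 1) (h : ∀ k : ℕ, a * b * z * p ^ k ≠ 1) (n : ℕ) :
    (1 - a * b * z) * (1 - z) * gaussTerm a b p z n =
      (1 - a * z) * (1 - b * z) * gaussTerm a b p (z * p) n +
        ((1 - a * b * z) * (1 - p ^ (n + 1)) * gaussTerm a b p z n -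
          (1 - a * b * z) * (1 - p ^ (n + 1 + 1)) * gaussTerm a b p z (n + 1)) := by
  have h_shift (k : ℕ) : a * b * z * p * p ^ k ≠ 1 := by
    simpa only [mul_assoc, ← pow_succ'] using h (k + 1)
  have hden := qPoch_ne_zero h_shift (n + 1)
  have hpoch := qPoch_self_ne_zero hp (n + 1)
  have hfirst : 1 - a * b * z ≠ 0 := sub_ne_zero.mpr (by simpa using (h 0).symm)
  have hlast : 1 - a * b * z * p ^ (n + 1) ≠ 0 := sub_ne_zero.mpr (h _).symm
  have hfactor : 1 - p ^ (n + 1 + 1) ≠ 0 :=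
    one_sub_ne_zero_of_norm_lt_one (norm_pow_succ_lt_one hp (n + 1))
  have den_eq : qPoch (a * b * z) p (n + 1) =
      (1 - a * b * z) * qPoch (a * b * z * p) p (n + 1) / (1 - a * b * z * p ^ (n + 1)) := by
    rw [← qPoch_succ', qPoch_succ _ _ (n + 1), mul_div_cancel_right₀ _ hlast]
  simp only [gaussTerm, qPoch_succ (a * p) p n, qPoch_succ b p (n + 1), qPoch_succ p p (n + 1),
    qPoch_succ' (a * b * z) p (n + 1), den_eq, ← mul_assoc, mul_pow]
  simp only [mul_assoc a p, ← pow_succ' p]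
  field_simp
  ring

theorem exists_norm_gaussTerm_le (hp : ‖p‖ < 1) (h : ∀ k : ℕ, a * b * z * p ^ k ≠ 1) :
    ∃ C : ℝ, 0 ≤ C ∧ ∀ k n, ‖gaussTerm a b p (z * p ^ k) n‖ ≤ C * ‖z * p ^ k‖ ^ (n + 1) := by
  obtain ⟨C₁, hC₁⟩ := exists_norm_inv_qPoch_le hp (mul_pow_ne_one hp hp.le)
  obtain ⟨C₂, hC₂⟩ := exists_norm_inv_qPoch_mul_pow_le hp h
  have hC₁_nonneg : 0 ≤ C₁ := (norm_nonneg _).trans (hC₁ 0)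
  have hC₂_nonneg : 0 ≤ C₂ := (norm_nonneg _).trans (hC₂ 0 0)
  refine ⟨Real.exp (‖a * p‖ / (1 - ‖p‖)) * Real.exp (‖b‖ / (1 - ‖p‖)) * C₁ * C₂, by positivity,
    fun k n => ?_⟩
  have split : ‖gaussTerm a b p (z * p ^ k) n‖ =
      ‖qPoch (a * p) p n‖ * ‖qPoch b p (n + 1)‖ * ‖(qPoch p p (n + 1))⁻¹‖ *
        ‖(qPoch (a * b * z * p ^ k) p (n + 1))⁻¹‖ * ‖z * p ^ k‖ ^ (n + 1) := by
    simp only [← norm_mul, ← norm_pow, gaussTerm]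
    congr 1
    rw [← mul_assoc (a * b)]
    ring
  rw [split]
  gcongr
  · exact norm_qPoch_le le_rfl hp n
  · exact norm_qPoch_le le_rfl hp _
  · exact hC₁ _
  · exact hC₂ k _

theorem summable_gaussTerm (hp : ‖p‖ < 1) (hz : ‖z‖ < 1) (h : ∀ k : ℕ, a * b * z * p ^ k ≠ 1) :
    Summable (gaussTerm a b p z) := by
  obtain ⟨C, -, hC⟩ := exists_norm_gaussTerm_le hp h
  exact .of_norm_bounded (summable_const_mul_norm_pow_succ hz C) fun n => by simpa using hC 0 n

theorem tsum_gaussTerm_functional (hp : ‖p‖ < 1) (hz : ‖z‖ < 1)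
    (h : ∀ k : ℕ, a * b * z * p ^ k ≠ 1) :
    (1 - a * b * z) * (1 - z) * ∑' n, gaussTerm a b p z n =
      (1 - b) * z + (1 - a * z) * (1 - b * z) * ∑' n, gaussTerm a b p (z * p) n := by
  have hzp : ‖z * p‖ < 1 := by simpa using (norm_mul_pow_le hp.le z 1).trans_lt hz
  have h_shift (k : ℕ) : a * b * (z * p) * p ^ k ≠ 1 := by
    simpa only [mul_assoc, ← pow_succ'] using h (k + 1)
  have hsum := summable_gaussTerm hp hz h
  rw [← tsum_mul_left, ← tsum_mul_left, tsum_eq_of_telescope (hsum.mul_left _)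
    ((summable_gaussTerm hp hzp h_shift).mul_left _) (gaussTerm_telescope hp h)]
  · have hfirst : 1 - a * b * z ≠ 0 := sub_ne_zero.mpr (by simpa using (h 0).symm)
    have hone : 1 - p ≠ 0 := one_sub_ne_zero_of_norm_lt_one hp
    simp only [gaussTerm, zero_add, qPoch_zero, qPoch_one, pow_one]
    field_simp
  · have hpow : Tendsto (fun n : ℕ => 1 - p ^ (n + 1)) atTop (𝓝 1) := by
      simpa using ((tendsto_pow_atTop_nhds_zero_of_norm_lt_one hp).comp
        (tendsto_add_atTop_nat 1)).const_sub 1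
    simpa using (hpow.const_mul (1 - a * b * z)).mul hsum.tendsto_atTop_zero

theorem qPochInf_mul_one_add_tsum_gaussTerm (hp : ‖p‖ < 1) (hz : ‖z‖ < 1)
    (h : ∀ k : ℕ, a * b * z * p ^ k ≠ 1) :
    qPochInf (a * b * z) p * qPochInf z p * (1 + (1 - a) * ∑' n, gaussTerm a b p z n) =
      qPochInf (a * z) p * qPochInf (b * z) p := by
  set F : ℕ → ℂ := fun k => 1 + (1 - a) * ∑' n, gaussTerm a b p (z * p ^ k) n with hF
  have F_functional (k : ℕ) : (1 - a * b * z * p ^ k) * (1 - z * p ^ k) * F k =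
      (1 - a * z * p ^ k) * (1 - b * z * p ^ k) * F (k + 1) := by
    have := tsum_gaussTerm_functional (a := a) (b := b) hp ((norm_mul_pow_le hp.le z k).trans_lt hz)
      fun j => by simpa only [mul_assoc, ← pow_add] using h (k + j)
    simp only [hF, pow_succ, ← mul_assoc] at this ⊢
    linear_combination (1 - a) * this
  have F_iterate (K : ℕ) : qPoch (a * b * z) p K * qPoch z p K * F 0 =
      qPoch (a * z) p K * qPoch (b * z) p K * F K := by
    induction K with
    | zero => simp [qPoch_zero]
    | succ K ih =>
      simp only [qPoch_succ]
      linear_combination (1 - a * b * z * p ^ K) * (1 - z * p ^ K) * ih +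
        qPoch (a * z) p K * qPoch (b * z) p K * F_functional K
  have F_tendsto : Tendsto F atTop (𝓝 1) := by
    obtain ⟨C, hC₀, hC⟩ := exists_norm_gaussTerm_le hp h
    simpa using ((tendsto_tsum_zero_of_norm_le_mul_pow hp (fun _ => hC₀)
      (summable_const_mul_norm_pow_succ hz C) hC).const_mul (1 - a)).const_add 1
  have lhs := ((tendsto_qPoch hp (a * b * z)).mul (tendsto_qPoch hp z)).mul_const (F 0)
  have rhs := ((tendsto_qPoch hp (a * z)).mul (tendsto_qPoch hp (b * z))).mul F_tendsto
  simp only [F_iterate] at lhs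
  simpa [hF] using tendsto_nhds_unique lhs rhs

theorem hasSum_gauss (hp : ‖p‖ < 1) (hz : ‖z‖ < 1) (h : ∀ k : ℕ, a * b * z * p ^ k ≠ 1) :
    HasSum (fun m => qPoch a p m * qPoch b p m * z ^ m / (qPoch p p m * qPoch (a * b * z) p m))
      (qPochInf (a * z) p * qPochInf (b * z) p / (qPochInf (a * b * z) p * qPochInf z p)) := by
  have hne : qPochInf (a * b * z) p * qPochInf z p ≠ 0 :=
    mul_ne_zero (qPochInf_ne_zero hp h) (qPochInf_ne_zero hp (mul_pow_ne_one hz hp.le))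
  rw [← qPochInf_mul_one_add_tsum_gaussTerm hp hz h, mul_div_cancel_left₀ _ hne,
    ← hasSum_nat_add_iff' 1]
  simpa only [← one_sub_mul_gaussTerm, Finset.sum_range_one, qPoch_zero, pow_zero, mul_one,
    div_one, add_sub_cancel_left] using (summable_gaussTerm hp hz h).hasSum.mul_left (1 - a)

/-- The case `a = 1` of the functional equation, in which the factors `1 - b z` cancel. -/
theorem tendsto_sum_lambert (hp : ‖p‖ < 1) (hz : ‖z‖ < 1) (h : ∀ k : ℕ, b * z * p ^ k ≠ 1) :
    Tendsto (fun K => ∑ k ∈ Finset.range K,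
        (1 - b) * (z * p ^ k) / ((1 - b * (z * p ^ k)) * (1 - z * p ^ k)))
      atTop (𝓝 (∑' n, gaussTerm 1 b p z n)) := by
  have h_one (k : ℕ) : 1 * b * z * p ^ k ≠ 1 := by rw [one_mul]; exact h k
  obtain ⟨C, hC₀, hC⟩ := exists_norm_gaussTerm_le hp h_one
  have := tendsto_sum_of_functional_eq (f := fun k => ∑' n, gaussTerm 1 b p (z * p ^ k) n)
    (g := fun k => (1 - b) * (z * p ^ k) / ((1 - b * (z * p ^ k)) * (1 - z * p ^ k)))
    (fun k => ?_) (tendsto_tsum_zero_of_norm_le_mul_pow hp (fun _ => hC₀)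
      (summable_const_mul_norm_pow_succ hz C) hC)
  · simpa only [pow_zero, mul_one] using this
  · have hzk : ‖z * p ^ k‖ < 1 := (norm_mul_pow_le hp.le z k).trans_lt hz
    have hb : 1 - b * (z * p ^ k) ≠ 0 := sub_ne_zero.mpr (by rw [← mul_assoc]; exact (h k).symm)
    have hone := one_sub_ne_zero_of_norm_lt_one hzk
    have := tsum_gaussTerm_functional (a := 1) (b := b) hp hzk
      fun j => by simpa only [mul_assoc, ← pow_add] using h_one (k + j)
    simp only [one_mul, mul_assoc z, ← pow_succ] at this
    rw [div_add' _ _ _ (mul_ne_zero hb hone), eq_div_iff (mul_ne_zero hb hone)]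
    linear_combination this

end GaussSum

section BilateralSums

theorem qPochInf_div_pow {u p : ℂ} (hp : ‖p‖ < 1) (hp₀ : p ≠ 0) (hu : u ≠ 0) (N : ℕ) :
    qPochInf (u / p ^ N) p =
      (-u) ^ N / p ^ ((N + 1).choose 2) * qPoch (p / u) p N * qPochInf u p := by
  rw [← qPoch_mul_qPochInf hp _ N, qPoch_div_pow hu hp₀, div_mul_cancel₀ u (pow_ne_zero N hp₀)]

theorem tendsto_tsum_shift_mul {𝕜 : Type*} [NormedDivisionRing 𝕜] [CompleteSpace 𝕜]
    {g : ℤ → 𝕜} {c : ℕ → 𝕜} {l : 𝕜} (hg : Summable fun k => ‖g k‖)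
    (hc : Tendsto c atTop (𝓝 l)) :
    Tendsto (fun N : ℕ => ∑' m : ℕ, g (m - N) * c m) atTop (𝓝 ((∑' k, g k) * l)) := by
  obtain ⟨C, hC⟩ := hc.norm.bddAbove_range
  have hC_le (m : ℕ) : ‖c m‖ ≤ C := hC ⟨m, rfl⟩
  let f (N : ℕ) (k : ℤ) : 𝕜 := if 0 ≤ k + N then g k * c (k + N).toNat else 0
  have tsum_f (N : ℕ) : ∑' m : ℕ, g (m - N) * c m = ∑' k, f N k := by
    have hinj : Function.Injective fun m : ℕ => (m : ℤ) - N := fun m n h => by simpa using h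
    rw [← hinj.tsum_eq (f := f N) fun k hk => ?_]
    · simp [f]
    · have hk_nonneg : 0 ≤ k + N := by_contra fun h => hk (if_neg h)
      exact ⟨(k + N).toNat, by simp [Int.toNat_of_nonneg hk_nonneg]⟩
  simp only [tsum_f, ← tsum_mul_right]
  refine tendsto_tsum_of_dominated_convergence (hg.mul_right C) (fun k => ?_)
    (.of_forall fun N k => ?_)
  · have hidx : Tendsto (fun N : ℕ => (k + N).toNat) atTop atTop :=
      tendsto_atTop.mpr fun M => (eventually_ge_atTop (M + k.natAbs)).mono fun N hN => by omega
    refine ((hc.comp hidx).const_mul (g k)).congr' ?_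
    filter_upwards [eventually_ge_atTop k.natAbs] with N hN
    exact (if_pos (show 0 ≤ k + N by omega)).symm
  · by_cases h : 0 ≤ k + N
    · simp only [f, if_pos h, norm_mul]
      gcongr
      exact hC_le _
    · simp only [f, if_neg h, norm_zero]
      exact mul_nonneg (norm_nonneg _) ((norm_nonneg _).trans (hC_le 0))

theorem summable_pow_div_one_sub {x p : ℂ} (hx : ‖x‖ < 1) (hp : ‖p‖ < 1) (b : ℂ) :
    Summable fun n : ℕ => x ^ n / (1 - b * p ^ n) := by
  have hlim : Tendsto (fun n : ℕ => (1 - b * p ^ n)⁻¹) atTop (𝓝 1) := by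
    simpa using (((tendsto_pow_atTop_nhds_zero_of_norm_lt_one hp).const_mul b).const_sub 1).inv₀
      (by simp)
  refine summable_of_isBigO_nat (summable_geometric_of_lt_one (norm_nonneg x) hx) ?_
  simpa [div_eq_mul_inv] using (Asymptotics.isBigO_refl (fun n : ℕ => x ^ n) atTop).norm_right.mul
    (hlim.isBigO_one ℝ)

theorem zpow_neg_div_one_sub {p b : ℂ} (x : ℂ) (hp : p ≠ 0) (hb : b ≠ 0) (n : ℕ) :
    x ^ (-(n + 1 : ℤ)) / (1 - b * p ^ (-(n + 1 : ℤ))) =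
      -(b⁻¹ * (p / x) * ((p / x) ^ n / (1 - b⁻¹ * p * p ^ n))) := by
  have hden : 1 - b * (p ^ (n + 1))⁻¹ = -(b * (p ^ (n + 1))⁻¹ * (1 - b⁻¹ * p * p ^ n)) := by
    field_simp
    ring
  rw [zpow_neg, zpow_neg, ← Nat.cast_succ, zpow_natCast, zpow_natCast, hden]
  simp only [div_eq_mul_inv, mul_inv, inv_neg, inv_inv, mul_pow, inv_pow, pow_succ]
  ring

theorem summable_zpow_div_one_sub {x p b : ℂ} (hp₀ : p ≠ 0) (hpx : ‖p‖ < ‖x‖) (hx : ‖x‖ < 1)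
    (hb : b ≠ 0) : Summable fun k : ℤ => x ^ k / (1 - b * p ^ k) := by
  have hx₀ : x ≠ 0 := norm_pos_iff.mp ((norm_nonneg p).trans_lt hpx)
  have hdiv : ‖p / x‖ < 1 := by
    rw [norm_div]
    exact (div_lt_one (norm_pos_iff.mpr hx₀)).mpr hpx
  refine .of_nat_of_neg_add_one ?_ ?_
  · simpa only [zpow_natCast] using summable_pow_div_one_sub hx (hpx.trans hx) b
  · simp only [zpow_neg_div_one_sub x hp₀ hb]
    exact ((summable_pow_div_one_sub hdiv (hpx.trans hx) _).mul_left _).neg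

/-- The `q`-Gauss sum with `b = p / z`, where `(a; p)_m / (ap; p)_m` collapses. -/
theorem hasSum_qPoch_div_one_sub {a x p : ℂ} (hp : ‖p‖ < 1) (hx₀ : x ≠ 0) (hx : ‖x‖ < 1)
    (h : ∀ k : ℕ, a * p ^ k ≠ 1) :
    HasSum (fun m => x ^ m / (1 - a * p ^ m) * (qPoch (p / x) p m / qPoch p p m))
      (qPochInf (a * x) p * qPochInf p p / (qPochInf a p * qPochInf x p)) := by
  have habz : a * (p / x) * x = a * p := by field_simp
  have hfirst : 1 - a ≠ 0 := sub_ne_zero.mpr (by simpa using (h 0).symm)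
  have h_shift (k : ℕ) : a * p * p ^ k ≠ 1 := by
    simpa only [mul_assoc, ← pow_succ'] using h (k + 1)
  have hgauss := (hasSum_gauss (a := a) (b := p / x) hp hx
    (by simpa only [habz] using h_shift)).div_const (1 - a)
  rw [habz, div_mul_cancel₀ p hx₀] at hgauss
  have hterm (m : ℕ) : qPoch a p m * qPoch (p / x) p m * x ^ m /
      (qPoch p p m * qPoch (a * p) p m) / (1 - a) =
        x ^ m / (1 - a * p ^ m) * (qPoch (p / x) p m / qPoch p p m) := by
    have hlast : 1 - a * p ^ m ≠ 0 := sub_ne_zero.mpr (h m).symm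
    have hden := qPoch_ne_zero h_shift m
    have hpoch := qPoch_self_ne_zero hp m
    have collapse : qPoch a p m = (1 - a) * qPoch (a * p) p m / (1 - a * p ^ m) := by
      rw [← qPoch_succ', qPoch_succ, mul_div_cancel_right₀ _ hlast]
    rw [collapse]
    field_simp
  have hvalue : qPochInf (a * p) p * qPochInf x p * (1 - a) = qPochInf a p * qPochInf x p := by
    rw [← qPoch_mul_qPochInf hp a 1, qPoch_one, pow_one]
    ring
  simpa only [hterm, div_div _ _ (1 - a), hvalue] using hgauss

theorem tsum_zpow_shift_div_one_sub {x p b : ℂ} (hp : ‖p‖ < 1) (hp₀ : p ≠ 0) (hx₀ : x ≠ 0)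
    (hx : ‖x‖ < 1) (hb₀ : b ≠ 0) (hb : ∀ k : ℤ, b * p ^ k ≠ 1) (N : ℕ) :
    ∑' m : ℕ, x ^ ((m : ℤ) - N) / (1 - b * p ^ ((m : ℤ) - N)) *
      (qPoch (p / x) p m / qPoch p p m) = qPoch (p / (b * x)) p N / qPoch (p / b) p N *
        (qPochInf (b * x) p * qPochInf p p / (qPochInf b p * qPochInf x p)) := by
  have hN := hasSum_qPoch_div_one_sub (a := b / p ^ N) hp hx₀ hx fun k => by
    simpa only [zpow_sub₀ hp₀, zpow_natCast, mul_div_assoc', div_mul_eq_mul_div] using hb (k - N)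
  have hterm (m : ℕ) : x ^ m / (1 - b / p ^ N * p ^ m) * (qPoch (p / x) p m / qPoch p p m) =
      x ^ N * (x ^ ((m : ℤ) - N) / (1 - b * p ^ ((m : ℤ) - N)) *
        (qPoch (p / x) p m / qPoch p p m)) := by
    rw [zpow_sub₀ hp₀, zpow_sub₀ hx₀]
    simp only [zpow_natCast]
    field_simp
  have htsum := hN.tsum_eq
  rw [div_mul_eq_mul_div, qPochInf_div_pow hp hp₀ (mul_ne_zero hb₀ hx₀),
    qPochInf_div_pow hp hp₀ hb₀, tsum_congr hterm, tsum_mul_left, ← neg_mul, mul_pow] at htsum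
  have hneg : -b ≠ 0 := neg_ne_zero.mpr hb₀
  refine mul_left_cancel₀ (pow_ne_zero N hx₀) (htsum.trans ?_)
  field_simp

/-- Kronecker's bilateral sum, a case of Ramanujan's `₁ψ₁` sum. -/
theorem tsum_zpow_div_one_sub {x p b : ℂ} (hp₀ : p ≠ 0) (hpx : ‖p‖ < ‖x‖) (hx : ‖x‖ < 1)
    (hb₀ : b ≠ 0) (hb : ∀ k : ℤ, b * p ^ k ≠ 1) :
    ∑' k : ℤ, x ^ k / (1 - b * p ^ k) =
      qPochInf p p ^ 2 * (qPochInf (b * x) p * qPochInf (p / (b * x)) p) /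
        (qPochInf x p * qPochInf (p / x) p * (qPochInf b p * qPochInf (p / b) p)) := by
  have hp := hpx.trans hx
  have hx₀ : x ≠ 0 := norm_pos_iff.mp ((norm_nonneg p).trans_lt hpx)
  have hpinf : qPochInf p p ≠ 0 := qPochInf_ne_zero hp (mul_pow_ne_one hp hp.le)
  have hdiv : ‖p / x‖ < 1 := by
    rw [norm_div]
    exact (div_lt_one (norm_pos_iff.mpr hx₀)).mpr hpx
  have hxinf : qPochInf (p / x) p ≠ 0 := qPochInf_ne_zero hp (mul_pow_ne_one hdiv hp.le)
  have hb_div (k : ℕ) : p / b * p ^ k ≠ 1 := fun h => hb (-(k + 1)) <| by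
    rw [zpow_neg, ← div_eq_mul_inv, div_eq_one_iff_eq (zpow_ne_zero _ hp₀)]
    rw [div_mul_eq_mul_div, div_eq_one_iff_eq hb₀, ← pow_succ'] at h
    exact_mod_cast h.symm
  have lhs := tendsto_tsum_shift_mul (summable_zpow_div_one_sub hp₀ hpx hx hb₀).norm
    ((tendsto_qPoch hp (p / x)).div (tendsto_qPoch hp p) hpinf)
  have rhs := ((tendsto_qPoch hp (p / (b * x))).div (tendsto_qPoch hp (p / b))
    (qPochInf_ne_zero hp hb_div)).mul_const
      (qPochInf (b * x) p * qPochInf p p / (qPochInf b p * qPochInf x p))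
  have := tendsto_nhds_unique lhs (rhs.congr fun N =>
    (tsum_zpow_shift_div_one_sub hp hp₀ hx₀ hx hb₀ hb N).symm)
  rw [← eq_div_iff (div_ne_zero hxinf hpinf)] at this
  rw [this]
  field_simp

end BilateralSums

section ThetaFunction

theorem choose_two_eq_half (n : ℕ) : (n + 1).choose 2 = n * (n + 1) / 2 := by
  rw [Nat.choose_two_right, Nat.add_sub_cancel, mul_comm]

theorem pow_succ_choose_two (p : ℂ) (n : ℕ) : p ^ (n + 1).choose 2 = p ^ n * p ^ n.choose 2 := by
  rw [Nat.choose_succ_succ' n, Nat.choose_one_right, pow_add]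

theorem summable_pow_mul_pow_choose_two {p : ℂ} (hp : ‖p‖ < 1) (w : ℂ) :
    Summable fun n : ℕ => w ^ n * p ^ n.choose 2 := by
  have hlim : Tendsto (fun n : ℕ => ‖w * p ^ n‖) atTop (𝓝 0) := by
    simpa using ((tendsto_pow_atTop_nhds_zero_of_norm_lt_one hp).const_mul w).norm
  refine summable_of_ratio_norm_eventually_le (r := 1 / 2) (by norm_num) ?_
  filter_upwards [hlim.eventually_le_const (by norm_num : (0 : ℝ) < 1 / 2)] with n hn
  have ratio : w ^ (n + 1) * p ^ (n + 1).choose 2 = w * p ^ n * (w ^ n * p ^ n.choose 2) := by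
    rw [pow_succ_choose_two]
    ring
  rw [ratio, norm_mul]
  gcongr

theorem summable_euler {p : ℂ} (hp : ‖p‖ < 1) (w : ℂ) :
    Summable fun n : ℕ => w ^ n * p ^ n.choose 2 / qPoch p p n := by
  obtain ⟨C, hC⟩ := exists_norm_inv_qPoch_le hp (mul_pow_ne_one hp hp.le)
  refine .of_norm_bounded ((summable_pow_mul_pow_choose_two hp w).norm.mul_right C) fun n => ?_
  rw [div_eq_mul_inv, norm_mul]
  gcongr
  exact hC n

theorem tsum_euler_functional {p : ℂ} (hp : ‖p‖ < 1) (w : ℂ) :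
    ∑' n : ℕ, (-w) ^ n * p ^ n.choose 2 / qPoch p p n =
      (1 - w) * ∑' n : ℕ, (-(w * p)) ^ n * p ^ n.choose 2 / qPoch p p n := by
  have hw := summable_euler hp (-w)
  have hwp := summable_euler hp (-(w * p))
  have step (n : ℕ) : (-w) ^ (n + 1) * p ^ (n + 1).choose 2 / qPoch p p (n + 1) =
      (-(w * p)) ^ (n + 1) * p ^ (n + 1).choose 2 / qPoch p p (n + 1) -
        w * ((-(w * p)) ^ n * p ^ n.choose 2 / qPoch p p n) := by
    have hpoch := qPoch_self_ne_zero hp n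
    have hlast := one_sub_ne_zero_of_norm_lt_one (norm_pow_succ_lt_one hp n)
    rw [qPoch_succ, ← pow_succ', pow_succ_choose_two, ← neg_mul, mul_pow, mul_pow]
    field_simp
    ring
  rw [hw.tsum_eq_zero_add, tsum_congr step,
    ((summable_nat_add_iff 1).mpr hwp).tsum_sub (hwp.mul_left w), tsum_mul_left, one_sub_mul,
    hwp.tsum_eq_zero_add]
  simp only [pow_zero]
  ring

theorem tsum_euler {p : ℂ} (hp : ‖p‖ < 1) (w : ℂ) :
    ∑' n : ℕ, (-w) ^ n * p ^ n.choose 2 / qPoch p p n = qPochInf w p := by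
  set E : ℕ → ℂ := fun k => ∑' n : ℕ, (-(w * p ^ k)) ^ n * p ^ n.choose 2 / qPoch p p n with hE
  have E_iterate (K : ℕ) : qPoch w p K * E K = E 0 := by
    induction K with
    | zero => rw [qPoch_zero, one_mul]
    | succ K ih =>
      rw [← ih, qPoch_succ, mul_assoc, hE]
      simp only [tsum_euler_functional hp (w * p ^ K), pow_succ, mul_assoc]
  have E_tendsto : Tendsto E atTop (𝓝 1) := by
    have tail := tendsto_tsum_zero_of_norm_le_mul_pow (c := w)
      (t := fun k n => (-(w * p ^ k)) ^ (n + 1) * p ^ (n + 1).choose 2 / qPoch p p (n + 1))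
      (B := fun n => ‖p ^ (n + 1).choose 2 / qPoch p p (n + 1)‖) hp (fun n => norm_nonneg _) ?_
      fun k n => ?_
    · simpa [hE, (summable_euler hp _).tsum_eq_zero_add, qPoch_zero] using tail.const_add 1
    · simpa only [mul_div_assoc, norm_mul, norm_pow, mul_comm] using
        ((summable_nat_add_iff 1).mpr (summable_euler hp w)).norm
    · rw [mul_div_assoc, norm_mul, norm_pow, norm_neg, mul_comm]
  have := tendsto_nhds_unique ((tendsto_qPoch hp w).mul E_tendsto)
    (tendsto_const_nhds.congr fun K => (E_iterate K).symm)
  simpa [hE] using this.symm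

theorem zchoose_natCast (n : ℕ) : (n : ℤ) * (n - 1) / 2 = n.choose 2 := by
  cases n with
  | zero => rfl
  | succ n => rw [choose_two_eq_half]; push_cast; ring_nf

theorem zchoose_neg_succ (n : ℕ) : (-(n + 1 : ℤ)) * (-(n + 1 : ℤ) - 1) / 2 = (n + 2).choose 2 := by
  rw [← zchoose_natCast]; push_cast; ring_nf

theorem zchoose_sub (m N : ℕ) : ((m : ℤ) - N) * ((m : ℤ) - N - 1) / 2 =
    m.choose 2 + (N + 1).choose 2 - N * m := by
  rw [← zchoose_natCast, ← zchoose_natCast]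
  have two_mul_zchoose (k : ℤ) : 2 * (k * (k - 1) / 2) = k * (k - 1) :=
    Int.mul_ediv_cancel' (Int.even_mul_pred_self k).two_dvd
  have hsub := two_mul_zchoose (m - N)
  have hm := two_mul_zchoose m
  have hN := two_mul_zchoose (N + 1)
  refine mul_left_cancel₀ (two_ne_zero (α := ℤ)) ?_
  push_cast
  linear_combination hsub - hm - hN

theorem summable_jacobi_triple {p : ℂ} (hp : ‖p‖ < 1) (u : ℂ) :
    Summable fun k : ℤ => u ^ k * p ^ (k * (k - 1) / 2) := by
  refine .of_nat_of_neg_add_one ?_ ?_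
  · simpa only [zchoose_natCast, zpow_natCast] using summable_pow_mul_pow_choose_two hp u
  · refine ((summable_pow_mul_pow_choose_two hp (u⁻¹ * p ^ 2)).mul_left (u⁻¹ * p)).congr fun n => ?_
    rw [zchoose_neg_succ, zpow_neg, ← Nat.cast_succ, zpow_natCast, zpow_natCast,
      pow_succ_choose_two, pow_succ_choose_two, mul_pow, inv_pow, Nat.succ_eq_add_one,
      pow_succ u, mul_inv]
    ring

theorem tsum_jacobi_triple {p u : ℂ} (hp : ‖p‖ < 1) (hp₀ : p ≠ 0) (hu : u ≠ 0) :
    ∑' k : ℤ, (-u) ^ k * p ^ (k * (k - 1) / 2) =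
      qPochInf u p * qPochInf (p / u) p * qPochInf p p := by
  have hneg : -u ≠ 0 := neg_ne_zero.mpr hu
  have hpinf : qPochInf p p ≠ 0 := qPochInf_ne_zero hp (mul_pow_ne_one hp hp.le)
  have shifted (N : ℕ) : ∑' m : ℕ, (-u) ^ ((m : ℤ) - N) *
      p ^ (((m : ℤ) - N) * ((m : ℤ) - N - 1) / 2) * (qPoch p p m)⁻¹ =
        qPoch (p / u) p N * qPochInf u p := by
    have hterm (m : ℕ) : (-u) ^ ((m : ℤ) - N) * p ^ (((m : ℤ) - N) * ((m : ℤ) - N - 1) / 2) *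
        (qPoch p p m)⁻¹ = p ^ (N + 1).choose 2 / (-u) ^ N *
          ((-(u / p ^ N)) ^ m * p ^ m.choose 2 / qPoch p p m) := by
      rw [zchoose_sub, zpow_sub₀ hneg, zpow_sub₀ hp₀, zpow_add₀ hp₀, ← neg_div, div_pow, ← pow_mul]
      simp only [zpow_natCast, ← Nat.cast_mul]
      field_simp
    rw [tsum_congr hterm, tsum_mul_left, tsum_euler hp, qPochInf_div_pow hp hp₀ hu]
    field_simp
  have lhs := tendsto_tsum_shift_mul (summable_jacobi_triple hp (-u)).norm
    ((tendsto_qPoch hp p).inv₀ hpinf)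
  have rhs := (tendsto_qPoch hp (p / u)).mul_const (qPochInf u p)
  have := tendsto_nhds_unique lhs (rhs.congr fun N => (shifted N).symm)
  rw [← div_eq_mul_inv, div_eq_iff hpinf] at this
  rw [this]
  ring

theorem two_mul_ramanujanPsi {q : ℂ} (hq : ‖q‖ < 1) (hq₀ : q ≠ 0) :
    2 * ramanujanPsi q = ∑' k : ℤ, q ^ k * q ^ (k * (k - 1) / 2) := by
  have hpos (n : ℕ) : q ^ (n : ℤ) * q ^ ((n : ℤ) * (n - 1) / 2) = q ^ (n * (n + 1) / 2) := by
    rw [zchoose_natCast, zpow_natCast, zpow_natCast, ← choose_two_eq_half, pow_succ_choose_two]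
  have hneg (n : ℕ) : q ^ (-(n + 1 : ℤ)) * q ^ (-(n + 1 : ℤ) * (-(n + 1 : ℤ) - 1) / 2) =
      q ^ (n * (n + 1) / 2) := by
    rw [zchoose_neg_succ, zpow_neg, ← Nat.cast_succ, zpow_natCast, zpow_natCast,
      pow_succ_choose_two q (n + 1), ← choose_two_eq_half, inv_mul_cancel_left₀ (pow_ne_zero _ hq₀)]
  have hsum : Summable fun n : ℕ => q ^ (n * (n + 1) / 2) := by
    simpa only [← choose_two_eq_half, pow_succ_choose_two] using
      summable_pow_mul_pow_choose_two hq q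
  rw [tsum_of_nat_of_neg_add_one (hsum.congr fun n => (hpos n).symm)
    (hsum.congr fun n => (hneg n).symm), tsum_congr hpos, tsum_congr hneg, ← two_mul, ramanujanPsi]

theorem ramanujanPsi_mul_qPochInf {q : ℂ} (hq : ‖q‖ < 1) (hq₀ : q ≠ 0) :
    ramanujanPsi q * qPochInf q (q ^ 2) = qPochInf (q ^ 2) (q ^ 2) := by
  have triple : ramanujanPsi q = qPochInf (-q) q ^ 2 * qPochInf q q := by
    have hone := qPoch_mul_qPochInf hq (-1) 1
    have := tsum_jacobi_triple hq hq₀ (neg_ne_zero.mpr hq₀)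
    simp only [neg_neg, div_neg, div_self hq₀, ← two_mul_ramanujanPsi hq hq₀] at this
    simp only [qPoch_one, pow_one, neg_mul, one_mul] at hone
    refine mul_left_cancel₀ (two_ne_zero (α := ℂ)) ?_
    rw [this, ← hone]
    ring
  have bisection := qPochInf_eq_prod hq q two_ne_zero
  have merge := qPochInf_mul_qPochInf_neg hq q
  have hne : qPochInf (q ^ 2) (q ^ 2) ≠ 0 := by
    have hq2 := norm_pow_succ_lt_one hq 1
    exact qPochInf_ne_zero hq2 (mul_pow_ne_one hq2 hq2.le)
  simp only [Finset.prod_range_succ, Finset.prod_range_zero, one_mul, pow_zero, mul_one, pow_one,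
    ← sq] at bisection
  have hcancel : qPochInf q (q ^ 2) * qPochInf (-q) q = 1 := by
    refine mul_right_cancel₀ hne ?_
    linear_combination merge - qPochInf (-q) q * bisection
  rw [triple, ← merge]
  linear_combination qPochInf (-q) q * qPochInf q q * hcancel

end ThetaFunction

/-- The term of index `n + 1` of `∑ (-p; p)_{m-1} (-c) ^ m / ((1 - p ^ m) (c; p)_m)`, a Lambert
series in disguise; `(-p; p)_{m-1}` is encoded as `(p ^ 2; p ^ 2)_{m-1} / (p; p)_{m-1}`. -/
noncomputable def lambertTerm (p c : ℂ) (n : ℕ) : ℂ :=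
  qPoch (p ^ 2) (p ^ 2) n * (-c) ^ (n + 1) / (qPoch p p (n + 1) * qPoch c p (n + 1))

section ThetaQuotient

variable {p c q : ℂ}

theorem gaussTerm_one_neg_one (p c : ℂ) (n : ℕ) :
    gaussTerm 1 (-1) p (-c) n = 2 * lambertTerm p c n := by
  simp only [gaussTerm, lambertTerm, ← qPoch_mul_qPoch_neg, qPoch_succ' (-1), one_mul, neg_mul,
    neg_neg]
  ring

theorem summable_lambertTerm (hp : ‖p‖ < 1) (hc : ‖c‖ < 1) : Summable (lambertTerm p c) := by
  have hsum := summable_gaussTerm (a := 1) (b := -1) (z := -c) hp (by rwa [norm_neg])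
    (by simpa using mul_pow_ne_one hc hp.le)
  simpa [gaussTerm_one_neg_one] using hsum.mul_left 2⁻¹

theorem tsum_lambertTerm (hp : ‖p‖ < 1) (hc : ‖c‖ < 1) :
    ∑' n, lambertTerm p c n = -(c * ∑' k : ℕ, p ^ k / (1 - c ^ 2 * (p ^ 2) ^ k)) := by
  have hterm (k : ℕ) : (1 - -1) * (-c * p ^ k) / ((1 - -1 * (-c * p ^ k)) * (1 - -c * p ^ k)) =
      2 * (-c * (p ^ k / (1 - c ^ 2 * (p ^ 2) ^ k))) := by
    rw [show 1 - c ^ 2 * (p ^ 2) ^ k = (1 - -1 * (-c * p ^ k)) * (1 - -c * p ^ k) by ring]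
    ring
  have lambert := tendsto_sum_lambert (b := -1) (z := -c) hp (by rwa [norm_neg])
    (by simpa using mul_pow_ne_one hc hp.le)
  simp only [hterm, gaussTerm_one_neg_one, tsum_mul_left] at lambert
  have hsum := summable_pow_div_one_sub hp (norm_pow_succ_lt_one hp 1) (c ^ 2)
  rw [← neg_mul, ← tsum_mul_left]
  exact mul_left_cancel₀ two_ne_zero (tendsto_nhds_unique lambert
    (by simpa only [tsum_mul_left] using ((hsum.mul_left (-c)).mul_left 2).hasSum.tendsto_sum_nat))

theorem ramanujanPsi_ne_zero (hq : ‖q‖ < 1) (hq₀ : q ≠ 0) : ramanujanPsi q ≠ 0 := by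
  have hq2 := norm_pow_succ_lt_one hq 1
  refine left_ne_zero_of_mul (b := qPochInf q (q ^ 2)) ?_
  rw [ramanujanPsi_mul_qPochInf hq hq₀]
  exact qPochInf_ne_zero hq2 (mul_pow_ne_one hq2 hq2.le)

theorem pow_three_pow_two (q : ℂ) : (q ^ 3) ^ 2 = q ^ 6 := by rw [← pow_mul]

theorem tsum_zpow_eq_ramanujanPsi_quotient (hq : ‖q‖ < 1) (hq₀ : q ≠ 0) :
    ∑' k : ℤ, (q ^ 3) ^ k / (1 - q ^ 2 * (q ^ 6) ^ k) =
      ramanujanPsi (q ^ 3) ^ 3 / ramanujanPsi q := by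
  have hq_pos : 0 < ‖q‖ := norm_pos_iff.mpr hq₀
  have hp : ‖q ^ 6‖ < 1 := norm_pow_succ_lt_one hq 5
  have hne (k : ℕ) : qPochInf (q ^ (k + 1)) (q ^ 6) ≠ 0 :=
    qPochInf_ne_zero hp (mul_pow_ne_one (norm_pow_succ_lt_one hq k) hp.le)
  have hpole (k : ℤ) : q ^ 2 * (q ^ 6) ^ k ≠ 1 := fun h => by
    have hzpow : ‖q‖ ^ (2 + 6 * k) = 1 := by
      rw [← norm_zpow, zpow_add₀ hq₀, zpow_mul]
      exact_mod_cast congrArg norm h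
    rcases zpow_eq_one_iff_right₀ (norm_nonneg q) hq.ne |>.mp hzpow with h
    omega
  have kronecker := tsum_zpow_div_one_sub (x := q ^ 3) (pow_ne_zero 6 hq₀)
    (by simpa only [norm_pow] using pow_lt_pow_right_of_lt_one₀ hq_pos hq (by norm_num))
    (norm_pow_succ_lt_one hq 2) (pow_ne_zero 2 hq₀) hpole
  have hdiv₅ : q ^ 6 / (q ^ 2 * q ^ 3) = q := by field_simp
  have hdiv₃ : q ^ 6 / q ^ 3 = q ^ 3 := by field_simp
  have hdiv₂ : q ^ 6 / q ^ 2 = q ^ 4 := by field_simp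
  have psi_q := ramanujanPsi_mul_qPochInf hq hq₀
  have psi_cube := ramanujanPsi_mul_qPochInf (norm_pow_succ_lt_one hq 2) (pow_ne_zero 3 hq₀)
  have hq2 := norm_pow_succ_lt_one hq 1
  rw [qPochInf_eq_prod hq2 q three_ne_zero, qPochInf_eq_prod hq2 (q ^ 2) three_ne_zero] at psi_q
  simp only [Finset.prod_range_succ, Finset.prod_range_zero, one_mul, ← pow_mul, ← pow_add,
    ← pow_succ', mul_zero, zero_add, mul_one, Nat.reduceMul, Nat.reduceAdd, pow_one]
    at psi_q
  rw [pow_three_pow_two] at psi_cube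
  rw [kronecker, hdiv₅, hdiv₃, hdiv₂, ← pow_add]
  have hpsi := ramanujanPsi_ne_zero hq hq₀
  have cubed := congrArg (· ^ 3) psi_cube
  rw [div_eq_div_iff (mul_ne_zero (mul_ne_zero (hne 2) (hne 2)) (mul_ne_zero (hne 1) (hne 3))) hpsi]
  refine mul_right_cancel₀ (hne 2) ?_
  linear_combination qPochInf (q ^ 6) (q ^ 6) ^ 2 * psi_q -
    qPochInf (q ^ 2) (q ^ 6) * qPochInf (q ^ 4) (q ^ 6) * cubed

theorem tsum_lambertTerm_sub (hq : ‖q‖ < 1) :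
    ∑' n, lambertTerm (q ^ 3) (q ^ 2) n - ∑' n, lambertTerm (q ^ 3) q n =
      q * (ramanujanPsi (q ^ 3) ^ 3 / ramanujanPsi q) := by
  rcases eq_or_ne q 0 with rfl | hq₀
  · simp [lambertTerm]
  have hp := norm_pow_succ_lt_one hq 2
  have hp₆ := norm_pow_succ_lt_one hq 5
  have hneg (n : ℕ) := zpow_neg_div_one_sub (q ^ 3) (pow_ne_zero 6 hq₀) (pow_ne_zero 2 hq₀) n
  have hdiv₃ : q ^ 6 / q ^ 3 = q ^ 3 := by field_simp
  have hdiv₂ : (q ^ 2)⁻¹ * q ^ 6 = q ^ 4 := by field_simp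
  have hdiv₁ : (q ^ 2)⁻¹ * q ^ 3 = q := by field_simp
  simp only [hdiv₁, hdiv₂, hdiv₃] at hneg
  have hpos (n : ℕ) : (q ^ 3) ^ (n : ℤ) / (1 - q ^ 2 * (q ^ 6) ^ (n : ℤ)) =
      (q ^ 3) ^ n / (1 - q ^ 2 * (q ^ 6) ^ n) := by simp only [zpow_natCast]
  rw [← tsum_zpow_eq_ramanujanPsi_quotient hq hq₀, tsum_of_nat_of_neg_add_one
    ((summable_pow_div_one_sub hp hp₆ _).congr fun n => (hpos n).symm)
    (((summable_pow_div_one_sub hp hp₆ _).mul_left q).neg.congr fun n => (hneg n).symm),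
    tsum_congr hpos, tsum_congr hneg, tsum_neg, tsum_mul_left,
    tsum_lambertTerm hp (norm_pow_succ_lt_one hq 1), tsum_lambertTerm hp hq, pow_three_pow_two,
    ← pow_mul]
  ring

end ThetaQuotient

/-- The general term, indexed from `0`, of the series in the first expansion. Up to sign it has the
same sum as `lambertTerm`, but it decays like `p ^ (n ^ 2 / 2)`. -/
noncomputable def quadraticLambertTerm (p c : ℂ) (n : ℕ) : ℂ :=
  c ^ (n + 1) * p ^ (n + 1).choose 2 * qPoch (-p) p n * (1 - c * p ^ (2 * n + 1)) /
    ((1 - p ^ (n + 1)) * (1 - c * p ^ n) * qPoch (-c) p (n + 1))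

section QuadraticLambert

variable {p c : ℂ}

theorem neg_mul_pow_ne_one (hp : ‖p‖ < 1) (hc : ‖c‖ < 1) (n : ℕ) : -c * p ^ n ≠ 1 :=
  mul_pow_ne_one (by rwa [norm_neg]) hp.le n

theorem exists_norm_quadraticLambertTerm_le (hp : ‖p‖ < 1) (hc : ‖c‖ < 1) :
    ∃ C : ℝ, 0 ≤ C ∧
      ∀ k n, ‖quadraticLambertTerm p (c * p ^ k) n‖ ≤ C * ‖c * p ^ k‖ ^ (n + 1) := by
  obtain ⟨C₁, hC₁⟩ := exists_norm_inv_qPoch_mul_pow_le hp (mul_pow_ne_one hp hp.le)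
  obtain ⟨C₂, hC₂⟩ := exists_norm_inv_qPoch_mul_pow_le hp (mul_pow_ne_one hc hp.le)
  obtain ⟨C₃, hC₃⟩ := exists_norm_inv_qPoch_mul_pow_le hp (neg_mul_pow_ne_one hp hc)
  have hC₁_nonneg : 0 ≤ C₁ := (norm_nonneg _).trans (hC₁ 0 0)
  have hC₂_nonneg : 0 ≤ C₂ := (norm_nonneg _).trans (hC₂ 0 0)
  have hC₃_nonneg : 0 ≤ C₃ := (norm_nonneg _).trans (hC₃ 0 0)
  refine ⟨Real.exp (‖-p‖ / (1 - ‖p‖)) * 2 * C₁ * C₂ * C₃, by positivity, fun k n => ?_⟩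
  have numerator_le : ‖1 - c * p ^ (k + (2 * n + 1))‖ ≤ 2 := by
    have := (norm_sub_le 1 _).trans (add_le_add_right (norm_mul_pow_le hp.le c (k + (2 * n + 1))) _)
    rw [norm_one] at this
    linarith
  have power_le : ‖p ^ (n + 1).choose 2‖ ≤ 1 := by
    rw [norm_pow]
    exact pow_le_one₀ (norm_nonneg p) hp.le
  have split : ‖quadraticLambertTerm p (c * p ^ k) n‖ =
      ‖p ^ (n + 1).choose 2‖ * ‖qPoch (-p) p n‖ * ‖1 - c * p ^ (k + (2 * n + 1))‖ *
        ‖(qPoch (p * p ^ n) p 1)⁻¹‖ * ‖(qPoch (c * p ^ (k + n)) p 1)⁻¹‖ *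
          ‖(qPoch (-c * p ^ k) p (n + 1))⁻¹‖ * ‖c * p ^ k‖ ^ (n + 1) := by
    simp only [← norm_mul, ← norm_pow, quadraticLambertTerm, qPoch_one, ← pow_succ', pow_add p k,
      ← mul_assoc c, neg_mul, div_eq_mul_inv, mul_inv]
    congr 1
    ring
  rw [split, ← one_mul (Real.exp _)]
  gcongr
  · exact norm_qPoch_le le_rfl hp n
  · exact hC₁ n 1
  · exact hC₂ (k + n) 1
  · exact hC₃ k _

theorem summable_quadraticLambertTerm (hp : ‖p‖ < 1) (hc : ‖c‖ < 1) :
    Summable (quadraticLambertTerm p c) := by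
  obtain ⟨C, -, hC⟩ := exists_norm_quadraticLambertTerm_le hp hc
  exact .of_norm_bounded (summable_const_mul_norm_pow_succ hc C) fun n => by simpa using hC 0 n

theorem quadraticLambertTerm_telescope (hp : ‖p‖ < 1) (hc : ‖c‖ < 1) (n : ℕ) :
    quadraticLambertTerm p c n = quadraticLambertTerm p (c * p) n +
      (quadraticLambertTerm p c n * ((1 - p ^ (n + 1)) / (1 - c * p ^ (2 * n + 1))) -
        quadraticLambertTerm p c (n + 1) *
          ((1 - p ^ (n + 1 + 1)) / (1 - c * p ^ (2 * (n + 1) + 1)))) := by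
  have hcp (k : ℕ) : 1 - c * p ^ k ≠ 0 :=
    one_sub_ne_zero_of_norm_lt_one ((norm_mul_pow_le hp.le c k).trans_lt hc)
  have hfirst : 1 + c ≠ 0 := by
    simpa using sub_ne_zero.mpr (neg_mul_pow_ne_one hp hc 0).symm
  have hlast : 1 + c * p ^ (n + 1) ≠ 0 := by
    simpa using sub_ne_zero.mpr (neg_mul_pow_ne_one hp hc (n + 1)).symm
  have hp₁ := one_sub_ne_zero_of_norm_lt_one (norm_pow_succ_lt_one hp n)
  have hp₂ := one_sub_ne_zero_of_norm_lt_one (norm_pow_succ_lt_one hp (n + 1))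
  have den_eq : qPoch (-c) p (n + 1) =
      (1 + c) * qPoch (-(c * p)) p (n + 1) / (1 + c * p ^ (n + 1)) := by
    rw [eq_div_iff hlast, ← neg_mul, ← sub_neg_eq_add 1 c, ← qPoch_succ', qPoch_succ _ _ (n + 1)]
    ring
  have shift (k : ℕ) : c * p * p ^ k = c * p ^ (k + 1) := by rw [mul_assoc, ← pow_succ']
  have h₀ := hcp n
  have h₁ := hcp (n + 1)
  have h₂ := hcp (2 * n + 1)
  have h₃ := hcp (2 * (n + 1) + 1)
  have boundary (m : ℕ) (hm : 1 - c * p ^ (2 * m + 1) ≠ 0) (hpm : 1 - p ^ (m + 1) ≠ 0) :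
      quadraticLambertTerm p c m * ((1 - p ^ (m + 1)) / (1 - c * p ^ (2 * m + 1))) =
        c ^ (m + 1) * p ^ (m + 1).choose 2 * qPoch (-p) p m /
          ((1 - c * p ^ m) * qPoch (-c) p (m + 1)) := by
    rw [quadraticLambertTerm]
    field_simp
  rw [boundary n h₂ hp₁, boundary (n + 1) h₃ hp₂]
  simp only [quadraticLambertTerm, qPoch_succ' (-c) p (n + 1), den_eq, qPoch_succ (-p) p n, neg_mul,
    pow_succ_choose_two p (n + 1), shift, sub_neg_eq_add, mul_pow]
  field_simp
  ring

theorem tsum_quadraticLambertTerm_functional (hp : ‖p‖ < 1) (hc : ‖c‖ < 1) :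
    ∑' n, quadraticLambertTerm p c n =
      c / (1 - c ^ 2) + ∑' n, quadraticLambertTerm p (c * p) n := by
  have hcp : ‖c * p‖ < 1 := by simpa using (norm_mul_pow_le hp.le c 1).trans_lt hc
  have hsum := summable_quadraticLambertTerm hp hc
  rw [tsum_eq_of_telescope hsum (summable_quadraticLambertTerm hp hcp)
    (U := fun n => quadraticLambertTerm p c n * ((1 - p ^ (n + 1)) / (1 - c * p ^ (2 * n + 1))))
    (quadraticLambertTerm_telescope hp hc)]
  · have hp₁ : 1 - p ≠ 0 := one_sub_ne_zero_of_norm_lt_one hp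
    have hc₁ : 1 - c ≠ 0 := one_sub_ne_zero_of_norm_lt_one hc
    have hc₂ : 1 - c * p ≠ 0 := one_sub_ne_zero_of_norm_lt_one hcp
    have hc₃ : 1 + c ≠ 0 := by simpa using sub_ne_zero.mpr (neg_mul_pow_ne_one hp hc 0).symm
    congr 1
    rw [show 1 - c ^ 2 = (1 - c) * (1 + c) by ring]
    simp only [quadraticLambertTerm, qPoch_zero, qPoch_one, zero_add, mul_zero, pow_zero, pow_one,
      mul_one, show Nat.choose 1 2 = 0 from rfl, sub_neg_eq_add]
    field_simp
  · have hpow (x : ℂ) {u : ℕ → ℕ} (hu : Tendsto u atTop atTop) :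
        Tendsto (fun n => 1 - x * p ^ u n) atTop (𝓝 1) := by
      simpa using
        (((tendsto_pow_atTop_nhds_zero_of_norm_lt_one hp).comp hu).const_mul x).const_sub 1
    have ratio := (hpow 1 (tendsto_add_atTop_nat 1)).div
      (hpow c (u := fun n => 2 * n + 1)
        (tendsto_atTop_mono (fun n => by simp only [id]; lia) tendsto_id))
      one_ne_zero
    simpa using hsum.tendsto_atTop_zero.mul ratio

theorem tsum_quadraticLambertTerm (hp : ‖p‖ < 1) (hc : ‖c‖ < 1) :
    ∑' n, quadraticLambertTerm p c n = -∑' n, lambertTerm p c n := by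
  obtain ⟨C, hC₀, hC⟩ := exists_norm_quadraticLambertTerm_le hp hc
  have lambert := tendsto_sum_of_functional_eq
    (f := fun k => ∑' n, quadraticLambertTerm p (c * p ^ k) n)
    (g := fun k => c * (p ^ k / (1 - c ^ 2 * (p ^ 2) ^ k))) (fun k => ?_)
    (tendsto_tsum_zero_of_norm_le_mul_pow hp (fun _ => hC₀)
      (summable_const_mul_norm_pow_succ hc C) hC)
  · have hsum := summable_pow_div_one_sub hp (norm_pow_succ_lt_one hp 1) (c ^ 2)
    rw [tsum_lambertTerm hp hc, neg_neg, ← tsum_mul_left]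
    simpa using tendsto_nhds_unique lambert (hsum.mul_left c).hasSum.tendsto_sum_nat
  · have := tsum_quadraticLambertTerm_functional hp ((norm_mul_pow_le hp.le c k).trans_lt hc)
    rw [mul_pow, ← pow_mul, mul_comm k, pow_mul] at this
    rwa [mul_assoc c, ← pow_succ, mul_div_assoc] at this

end QuadraticLambert

section SeriesSum

variable {u v : ℕ → ℂ} {s : ℂ}

theorem seriesSum_iff :
    SeriesSum u s ↔ Tendsto (fun N => ∑ n ∈ Finset.range N, u (n + 1)) atTop (𝓝 s) := by
  have shift (N : ℕ) : ∑ n ∈ Finset.Icc 1 N, u n = ∑ n ∈ Finset.range N, u (n + 1) := by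
    rw [Finset.range_eq_Ico, Finset.sum_Ico_add' u 0 N 1]
    rfl
  simp only [SeriesSum, shift]

theorem SeriesSum.congr (h : SeriesSum u s) (huv : ∀ n, v (n + 1) = u (n + 1)) :
    SeriesSum v s := by
  rw [seriesSum_iff] at h ⊢
  simpa only [huv] using h

theorem seriesSum_of_hasSum (h : HasSum (fun n => u (n + 1)) s) : SeriesSum u s :=
  seriesSum_iff.mpr h.tendsto_sum_nat

end SeriesSum

section BaileyLemma

theorem tendsto_sum_mul_pow_sub {x : ℕ → ℝ} {r : ℝ} (hr : 0 ≤ r) (hr₁ : r < 1)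
    (hx : Tendsto x atTop (𝓝 0)) :
    Tendsto (fun N => ∑ j ∈ Finset.range N, x j * r ^ (N - j)) atTop (𝓝 0) := by
  obtain ⟨B, hB⟩ := hx.abs.bddAbove_range
  have reflected (N : ℕ) : ∑ j ∈ Finset.range N, x j * r ^ (N - j) =
      ∑' i, if i < N then x (N - 1 - i) * r ^ (i + 1) else 0 := by
    rw [tsum_eq_sum (s := Finset.range N) fun k hk => if_neg (by simpa using hk),
      ← Finset.sum_range_reflect]
    refine Finset.sum_congr rfl fun k hk => ?_
    have hk := Finset.mem_range.mp hk
    rw [if_pos hk, show N - (N - 1 - k) = k + 1 by lia]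
  simp only [reflected]
  suffices h : Tendsto _ atTop (𝓝 (∑' _ : ℕ, (0 : ℝ))) by rwa [tsum_zero] at h
  refine tendsto_tsum_of_dominated_convergence (bound := fun i => B * r ^ (i + 1))
    (((summable_nat_add_iff 1).mpr (summable_geometric_of_lt_one hr hr₁)).mul_left B) (fun i => ?_)
    (Eventually.of_forall fun N i => ?_)
  · have hlim : Tendsto (fun N => x (N - 1 - i) * r ^ (i + 1)) atTop (𝓝 0) := by
      simpa using (hx.comp ((tendsto_sub_atTop_nat i).comp (tendsto_sub_atTop_nat 1))).mul_const
        (r ^ (i + 1))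
    refine hlim.congr' ?_
    filter_upwards [eventually_gt_atTop i] with N hN using (if_pos hN).symm
  · have hB₀ : 0 ≤ B := (abs_nonneg _).trans (hB ⟨0, rfl⟩)
    split_ifs
    · rw [norm_mul, Real.norm_of_nonneg (by positivity : 0 ≤ r ^ (i + 1))]
      gcongr
      exact hB ⟨_, rfl⟩
    · rw [norm_zero]
      positivity

theorem tendsto_sum_sum_mul_of_hasSum_one {R : Type*} [NormedRing R] {y : ℕ → R}
    {g : ℕ → ℕ → R} {A : R} {K r : ℝ} (hr : 0 ≤ r) (hr₁ : r < 1)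
    (hg : ∀ j m, ‖g j m‖ ≤ K * r ^ m) (hg₁ : ∀ j, HasSum (g j) 1)
    (hy : Tendsto (fun N => ∑ j ∈ Finset.range N, y j) atTop (𝓝 A)) :
    Tendsto (fun N => ∑ n ∈ Finset.range N, ∑ j ∈ Finset.range (n + 1), y j * g j (n - j))
      atTop (𝓝 A) := by
  have hy₀ : Tendsto (fun j => ‖y j‖) atTop (𝓝 0) := by
    simpa [Function.comp_def, Finset.sum_range_succ] using
      ((hy.comp (tendsto_add_atTop_nat 1)).sub hy).norm
  have row_error (N : ℕ) :
      ∑ n ∈ Finset.range N, ∑ j ∈ Finset.range (n + 1), y j * g j (n - j) -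
        ∑ j ∈ Finset.range N, y j =
      ∑ j ∈ Finset.range N, y j * (∑ m ∈ Finset.range (N - j), g j m - 1) := by
    simp only [Finset.sum_range_diag_flip N fun j m => y j * g j m, ← Finset.sum_sub_distrib,
      ← Finset.mul_sum, mul_sub_one]
  have error : Tendsto (fun N => ∑ j ∈ Finset.range N,
      y j * (∑ m ∈ Finset.range (N - j), g j m - 1)) atTop (𝓝 0) := by
    have bound := (tendsto_sum_mul_pow_sub hr hr₁ hy₀).const_mul (K / (1 - r))
    rw [mul_zero] at bound
    refine squeeze_zero_norm (fun N => (norm_sum_le _ _).trans ?_) bound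
    rw [Finset.mul_sum]
    gcongr with j
    calc ‖y j * (∑ m ∈ Finset.range (N - j), g j m - 1)‖
        ≤ ‖y j‖ * (K * r ^ (N - j) / (1 - r)) := by
          refine (norm_mul_le _ _).trans ?_
          gcongr
          exact norm_sub_le_of_geometric_bound_of_hasSum hr₁ (hg j) (hg₁ j) (N - j)
      _ = K / (1 - r) * (‖y j‖ * r ^ (N - j)) := by ring
  simpa [← row_error] using error.add hy

/-- The weight with which the `j`-th term of the `α`-series enters the `(j + m)`-th term of the
`β`-series in Bailey's lemma; it is normalised so that its sum over `m` is one. -/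
noncomputable def baileyWeight (p c : ℂ) (j m : ℕ) : ℂ :=
  qPoch (c ^ 2) (p ^ 2) j * qPoch (p ^ (2 * j)) (p ^ 2) m * (-c) ^ m /
    (qPoch p p m * qPoch c p (2 * j + m))

variable {a p c : ℂ}

theorem hasSum_baileyWeight (hp : ‖p‖ < 1) (hc : ‖c‖ < 1) (j : ℕ) :
    HasSum (baileyWeight p c j) 1 := by
  have hc' : ‖-c‖ < 1 := by rwa [norm_neg]
  have param : p ^ j * -p ^ j * -c = c * p ^ (2 * j) := by ring
  have hparam : ‖c * p ^ (2 * j)‖ < 1 := (norm_mul_pow_le hp.le c _).trans_lt hc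
  have gauss := hasSum_gauss (a := p ^ j) (b := -p ^ j) hp hc'
    (by simpa only [param] using mul_pow_ne_one hparam hp.le)
  have hc_ne := qPochInf_ne_zero hp (mul_pow_ne_one hc hp.le)
  have hc_ne' := qPochInf_ne_zero hp (mul_pow_ne_one hc' hp.le)
  have numerator : qPoch (c ^ 2) (p ^ 2) j * (qPochInf (p ^ j * -c) p * qPochInf (-p ^ j * -c) p) =
      qPochInf c p * qPochInf (-c) p := by
    rw [qPochInf_mul_qPochInf_neg hp, neg_mul, qPochInf_mul_qPochInf_neg hp,
      ← qPoch_mul_qPochInf (norm_pow_succ_lt_one hp 1) (c ^ 2) j]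
    ring_nf
  rw [param] at gauss
  have weight_eq (m : ℕ) : qPoch (c ^ 2) (p ^ 2) j / qPoch c p (2 * j) *
      (qPoch (p ^ j) p m * qPoch (-p ^ j) p m * (-c) ^ m /
        (qPoch p p m * qPoch (c * p ^ (2 * j)) p m)) = baileyWeight p c j m := by
    rw [baileyWeight, qPoch_add c p (2 * j), qPoch_mul_qPoch_neg, ← pow_mul, mul_comm j 2]
    ring
  have total := gauss.mul_left (qPoch (c ^ 2) (p ^ 2) j / qPoch c p (2 * j))
  rwa [funext weight_eq, div_mul_div_comm, numerator, ← mul_assoc, qPoch_mul_qPochInf hp,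
    div_self (mul_ne_zero hc_ne hc_ne')] at total

theorem exists_norm_baileyWeight_le (hp : ‖p‖ < 1) (hc : ‖c‖ < 1) :
    ∃ K : ℝ, ∀ j m, ‖baileyWeight p c j m‖ ≤ K * ‖c‖ ^ m := by
  have hp₂ := norm_pow_succ_lt_one hp 1
  obtain ⟨C₁, hC₁⟩ := exists_norm_inv_qPoch_le hp (mul_pow_ne_one hp hp.le)
  obtain ⟨C₂, hC₂⟩ := exists_norm_inv_qPoch_le hp (mul_pow_ne_one hc hp.le)
  have hC₁₀ : 0 ≤ C₁ := (norm_nonneg _).trans (hC₁ 0)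
  refine ⟨Real.exp (1 / (1 - ‖p ^ 2‖)) * Real.exp (1 / (1 - ‖p ^ 2‖)) * (C₁ * C₂),
    fun j m => ?_⟩
  have hpj : ‖p ^ (2 * j)‖ ≤ 1 := by
    rw [norm_pow]
    exact pow_le_one₀ (norm_nonneg p) hp.le
  calc ‖baileyWeight p c j m‖
      = ‖qPoch (c ^ 2) (p ^ 2) j‖ * ‖qPoch (p ^ (2 * j)) (p ^ 2) m‖ *
          (‖(qPoch p p m)⁻¹‖ * ‖(qPoch c p (2 * j + m))⁻¹‖) * ‖c‖ ^ m := by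
        rw [baileyWeight, div_eq_mul_inv, mul_inv, norm_mul, norm_mul, norm_mul, norm_mul, norm_pow,
          norm_neg]
        ring
    _ ≤ _ := by
        gcongr
        · exact norm_qPoch_le (norm_pow_succ_lt_one hc 1).le hp₂ j
        · exact norm_qPoch_le hpj hp₂ m
        · exact hC₁ m
        · exact hC₂ _

theorem IsBaileyPair.mul_beta_eq {α β : ℕ → ℂ} (h : IsBaileyPair a p α β) (hp : ‖p‖ < 1)
    (hac : a * p = c) (hc : ‖c‖ < 1) (n : ℕ) :
    qPoch (p ^ 2) (p ^ 2) n * (-c) ^ (n + 1) * β (n + 1) =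
      ∑ j ∈ Finset.range (n + 1), qPoch (p ^ 2) (p ^ 2) j * (-c) ^ (j + 1) /
        qPoch (c ^ 2) (p ^ 2) (j + 1) * α (j + 1) * baileyWeight p c (j + 1) (n - j) +
      lambertTerm p c n := by
  rw [h.beta_eq (n + 1) n.succ_pos, Finset.sum_range_succ', mul_add, Finset.mul_sum, hac,
    h.alpha_zero]
  congr 1
  · refine Finset.sum_congr rfl fun j hj => ?_
    obtain ⟨m, rfl⟩ := Nat.exists_eq_add_of_le (Nat.lt_succ_iff.mp (Finset.mem_range.mp hj))
    have hpoch := qPoch_ne_zero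
      (mul_pow_ne_one (norm_pow_succ_lt_one hc 1) (norm_pow_succ_lt_one hp 1).le) (j + 1)
    rw [Nat.add_sub_cancel_left, Nat.add_sub_add_right, Nat.add_sub_cancel_left, baileyWeight,
      show j + m + 1 + (j + 1) = 2 * (j + 1) + m by ring, qPoch_add (p ^ 2), ← pow_succ',
      ← pow_mul, add_right_comm j, pow_add (-c) (j + 1)]
    field_simp
  · simp only [lambertTerm, Nat.sub_zero, add_zero]
    ring

/-- The case `ρ₁ → 1`, `ρ₂ = -1` of Bailey's lemma; in this case the term containing `α 0` has a
limit independent of the pair, the Lambert series. -/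
theorem IsBaileyPair.seriesSum {α β : ℕ → ℂ} (h : IsBaileyPair a p α β) (hp : ‖p‖ < 1)
    (hac : a * p = c) (hc : ‖c‖ < 1) {A : ℂ}
    (hA : SeriesSum (fun n => qPoch (p ^ 2) (p ^ 2) (n - 1) * (-c) ^ n /
      qPoch (c ^ 2) (p ^ 2) n * α n) A) :
    SeriesSum (fun n => qPoch (p ^ 2) (p ^ 2) (n - 1) * (-c) ^ n * β n)
      (A + ∑' n, lambertTerm p c n) := by
  rw [seriesSum_iff] at hA ⊢
  obtain ⟨K, hK⟩ := exists_norm_baileyWeight_le hp hc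
  have weighted := tendsto_sum_sum_mul_of_hasSum_one (g := fun j => baileyWeight p c (j + 1))
    (norm_nonneg c) hc (fun j => hK (j + 1)) (fun j => hasSum_baileyWeight hp hc (j + 1)) hA
  refine (weighted.add (summable_lambertTerm hp hc).hasSum.tendsto_sum_nat).congr fun N => ?_
  simp only [← Finset.sum_add_distrib, Nat.add_sub_cancel, h.mul_beta_eq hp hac hc]

end BaileyLemma

section EvenPair

/-- The reciprocal `1 / (p; p)_{n - k}`, extended by zero to `k > n`. -/
noncomputable def invQPochSub (p : ℂ) (n k : ℕ) : ℂ :=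
  if k ≤ n then (qPoch p p (n - k))⁻¹ else 0

/-- The weight of a well-poised series with two parameters `a` and `e`; in the usual notation
`e = 1 / d`, and `e = 0` is the limit `d → ∞`. -/
noncomputable def evenWeight (a p e : ℂ) (j : ℕ) : ℂ :=
  qPoch a (p ^ 2) j * (∏ i ∈ Finset.range j, (e - (p ^ 2) ^ i)) * (a ^ j * p ^ (2 * j ^ 2)) /
    (qPoch (p ^ 2) (p ^ 2) j * qPoch (a * p ^ 2 * e) (p ^ 2) j)

/-- The term of index `2 j` of the sequence `α` of a Bailey pair with respect to `a` with base `p`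
and with a free parameter `e`, whose terms of odd index vanish. -/
noncomputable def evenAlpha (a p e : ℂ) (j : ℕ) : ℂ :=
  (1 - a * p ^ (4 * j)) / (1 - a) * evenWeight a p e j

/-- The sequence `β` of the Bailey pair of `evenAlpha`. -/
noncomputable def evenBeta (a p e : ℂ) (n : ℕ) : ℂ :=
  qPoch (a * p * e) (p ^ 2) n / (qPoch (a * p) (p ^ 2) n * (qPoch (a * p * e) p n * qPoch p p n))

/-- The summand of the sum that expresses `evenBeta a p e n` through `evenAlpha a p e`. -/
noncomputable def evenSummand (a p e : ℂ) (n j : ℕ) : ℂ :=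
  evenAlpha a p e j * (invQPochSub p n (2 * j) / qPoch (a * p) p (n + 2 * j))

/-- The Wilf–Zeilberger certificate of the recurrence in `n` satisfied by the sum of
`evenSummand` over `j`. -/
noncomputable def evenCertificate (a p e : ℂ) (n j : ℕ) : ℂ :=
  -(p ^ (n + 1)) * ((1 - p ^ (2 * j)) * (1 - a * e * p ^ (2 * j)) / (p ^ (2 * j) * (1 - a))) *
    evenWeight a p e j * (invQPochSub p (n + 1) (2 * j) *
      ((1 - a * p ^ (n + 2 * j)) / qPoch (a * p) p (n + 2 * j)))

variable {a p e c : ℂ}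

theorem invQPochSub_of_lt {n k : ℕ} (h : n < k) : invQPochSub p n k = 0 := if_neg h.not_ge

theorem invQPochSub_add_left (p : ℂ) (k m : ℕ) : invQPochSub p (k + m) k = (qPoch p p m)⁻¹ := by
  rw [invQPochSub, if_pos (Nat.le_add_right k m), Nat.add_sub_cancel_left]

theorem one_sub_mul_inv_qPoch_succ (hp : ‖p‖ < 1) (m : ℕ) :
    (1 - p ^ (m + 1)) * (qPoch p p (m + 1))⁻¹ = (qPoch p p m)⁻¹ := by
  have hm := one_sub_ne_zero_of_norm_lt_one (norm_pow_succ_lt_one hp m)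
  rw [qPoch_succ, ← pow_succ', mul_inv, mul_left_comm, mul_inv_cancel₀ hm, mul_one]

theorem invQPochSub_succ_left (hp₀ : p ≠ 0) (hp : ‖p‖ < 1) (n k : ℕ) :
    (1 - p ^ (n + 1) / p ^ k) * invQPochSub p (n + 1) k = invQPochSub p n k := by
  rcases lt_trichotomy k (n + 1) with h | rfl | h
  · obtain ⟨m, rfl⟩ := Nat.exists_eq_add_of_le (Nat.lt_succ_iff.mp h)
    rw [add_assoc, invQPochSub_add_left, invQPochSub_add_left, pow_add,
      mul_div_cancel_left₀ _ (pow_ne_zero k hp₀), one_sub_mul_inv_qPoch_succ hp]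
  · rw [invQPochSub_of_lt n.lt_succ_self, div_self (pow_ne_zero _ hp₀), sub_self, zero_mul]
  · rw [invQPochSub_of_lt h, invQPochSub_of_lt (n.lt_succ_self.trans h), mul_zero]

theorem invQPochSub_succ_right (hp₀ : p ≠ 0) (hp : ‖p‖ < 1) (n k : ℕ) :
    invQPochSub p n (k + 1) = (1 - p ^ n / p ^ k) * invQPochSub p n k := by
  rcases lt_trichotomy k n with h | rfl | h
  · obtain ⟨m, rfl⟩ := Nat.exists_eq_add_of_le (Nat.succ_le_of_lt h)
    rw [Nat.succ_eq_add_one, invQPochSub_add_left, add_assoc k, add_comm 1 m,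
      invQPochSub_add_left, pow_add, mul_div_cancel_left₀ _ (pow_ne_zero k hp₀),
      one_sub_mul_inv_qPoch_succ hp]
  · rw [invQPochSub_of_lt k.lt_succ_self, div_self (pow_ne_zero _ hp₀), sub_self, zero_mul]
  · rw [invQPochSub_of_lt h, invQPochSub_of_lt (h.trans k.lt_succ_self), mul_zero]

theorem evenWeight_succ (a p e : ℂ) (j : ℕ) :
    evenWeight a p e (j + 1) = evenWeight a p e j *
      ((1 - a * p ^ (2 * j)) * (e - p ^ (2 * j)) * (a * p ^ 2 * (p ^ (2 * j)) ^ 2) /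
        ((1 - p ^ 2 * p ^ (2 * j)) * (1 - a * p ^ 2 * e * p ^ (2 * j)))) := by
  simp only [evenWeight, qPoch_succ, Finset.prod_range_succ, ← pow_mul p 2, div_eq_mul_inv, mul_inv]
  ring

theorem evenAlpha_zero (p e : ℂ) (ha : a ≠ 1) : evenAlpha a p e 0 = 1 := by
  simp [evenAlpha, evenWeight, qPoch_zero, sub_ne_zero.mpr ha.symm]

theorem evenBeta_zero (a p e : ℂ) : evenBeta a p e 0 = 1 := by
  simp [evenBeta, qPoch_zero]

theorem evenSummand_of_lt {n j : ℕ} (h : n < 2 * j) : evenSummand a p e n j = 0 := by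
  rw [evenSummand, invQPochSub_of_lt h, zero_div, mul_zero]

theorem evenBeta_succ (a p e : ℂ) (n : ℕ) :
    (1 - a * p * e * (p ^ n) ^ 2) / ((1 - a * p * (p ^ n) ^ 2) * (1 - a * p * e * p ^ n) *
      (1 - p * p ^ n)) * evenBeta a p e n = evenBeta a p e (n + 1) := by
  simp only [evenBeta, qPoch_succ, ← pow_mul, mul_comm 2 n, div_eq_mul_inv, mul_inv]
  ring

theorem evenCertificate_succ (hp₀ : p ≠ 0) (hp : ‖p‖ < 1) (ha : ∀ k : ℕ, a * p ^ k ≠ 1)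
    (he : ∀ k : ℕ, a * p * e * p ^ k ≠ 1) (n j : ℕ) :
    evenCertificate a p e n (j + 1) =
      -(p ^ (n + 1)) * (a * p ^ (2 * j) * (1 - a * p ^ (2 * j)) * (e - p ^ (2 * j)) / (1 - a)) *
        evenWeight a p e j * ((1 - p ^ n / p ^ (2 * j)) * invQPochSub p n (2 * j) *
          (qPoch (a * p) p (n + 2 * j + 1))⁻¹) := by
  have h₁ : 1 - p ^ 2 * p ^ (2 * j) ≠ 0 := by
    rw [← pow_add, add_comm]
    exact one_sub_ne_zero_of_norm_lt_one (norm_pow_succ_lt_one hp _)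
  have h₂ : 1 - a * p ^ 2 * e * p ^ (2 * j) ≠ 0 := by
    rw [show a * p ^ 2 * e * p ^ (2 * j) = a * p * e * p ^ (2 * j + 1) by ring]
    exact sub_ne_zero.mpr (he _).symm
  have h₃ : 1 - a * p ^ (n + 2 * j + 2) ≠ 0 := sub_ne_zero.mpr (ha _).symm
  have hpj : p ^ (2 * j) ≠ 0 := pow_ne_zero _ hp₀
  have weight : (1 - p ^ (2 * j + 2)) * (1 - a * e * p ^ (2 * j + 2)) /
        (p ^ (2 * j + 2) * (1 - a)) * evenWeight a p e (j + 1) =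
      a * p ^ (2 * j) * (1 - a * p ^ (2 * j)) * (e - p ^ (2 * j)) / (1 - a) *
        evenWeight a p e j := by
    rw [evenWeight_succ, pow_add p (2 * j) 2, mul_comm _ (p ^ 2),
      show a * e * (p ^ 2 * p ^ (2 * j)) = a * p ^ 2 * e * p ^ (2 * j) by ring]
    generalize evenWeight a p e j = w, p ^ (2 * j) = z at *
    generalize 1 - p ^ 2 * z = b₁, 1 - a * p ^ 2 * e * z = b₂ at *
    field_simp
  have poch : (1 - a * p ^ (n + 2 * j + 2)) / qPoch (a * p) p (n + 2 * j + 2) =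
      (qPoch (a * p) p (n + 2 * j + 1))⁻¹ := by
    rw [qPoch_succ _ _ (n + 2 * j + 1), mul_assoc a p, ← pow_succ', div_mul_cancel_right₀ h₃]
  have inv : invQPochSub p (n + 1) (2 * j + 2) =
      (1 - p ^ n / p ^ (2 * j)) * invQPochSub p n (2 * j) := by
    rw [invQPochSub_succ_right hp₀ hp, invQPochSub_succ_right hp₀ hp,
      invQPochSub_succ_left hp₀ hp, pow_succ, pow_succ, mul_div_mul_right _ _ hp₀]
  rw [evenCertificate, mul_add_one, mul_assoc _ _ (evenWeight a p e (j + 1)), weight, inv,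
    ← add_assoc n, poch, ← mul_assoc (-_)]

theorem evenSummand_step (hp₀ : p ≠ 0) (hp : ‖p‖ < 1) (ha : ∀ k : ℕ, a * p ^ k ≠ 1)
    (he : ∀ k : ℕ, a * p * e * p ^ k ≠ 1) (n j : ℕ) :
    (1 - a * p * (p ^ n) ^ 2) * (1 - a * p * e * p ^ n) * (1 - p * p ^ n) *
        evenSummand a p e (n + 1) j =
      (1 - a * p * e * (p ^ n) ^ 2) * evenSummand a p e n j +
        (evenCertificate a p e n (j + 1) - evenCertificate a p e n j) := by
  have hap (k : ℕ) : 1 - a * p * p ^ k ≠ 0 := by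
    rw [mul_assoc, ← pow_succ']
    exact sub_ne_zero.mpr (ha _).symm
  have hpoch : qPoch (a * p) p (n + 2 * j) ≠ 0 :=
    Finset.prod_ne_zero_iff.mpr fun i _ => hap i
  have hlast : 1 - a * p * p ^ n * p ^ (2 * j) ≠ 0 := by
    simpa only [pow_add, ← mul_assoc] using hap (n + 2 * j)
  have ha₁ : 1 - a ≠ 0 := by simpa using sub_ne_zero.mpr (ha 0).symm
  have hpj : p ^ (2 * j) ≠ 0 := pow_ne_zero _ hp₀
  have poch_succ : qPoch (a * p) p (n + 2 * j + 1) =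
      qPoch (a * p) p (n + 2 * j) * (1 - a * p * p ^ n * p ^ (2 * j)) := by
    rw [qPoch_succ, pow_add, ← mul_assoc]
  rw [evenCertificate_succ hp₀ hp ha he, evenCertificate, evenSummand, evenSummand, evenAlpha,
    add_right_comm n 1, poch_succ, ← invQPochSub_succ_left hp₀ hp n,
    show 4 * j = 2 * j + 2 * j by ring, pow_add p (2 * j), pow_add p n (2 * j), pow_succ' p n]
  generalize evenWeight a p e j = w, invQPochSub p (n + 1) (2 * j) = v,
    qPoch (a * p) p (n + 2 * j) = Q, p ^ (2 * j) = z, p ^ n = y at *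
  clear hap poch_succ
  field_simp
  ring

theorem sum_evenSummand (hp₀ : p ≠ 0) (hp : ‖p‖ < 1) (ha : ∀ k : ℕ, a * p ^ k ≠ 1)
    (he : ∀ k : ℕ, a * p * e * p ^ k ≠ 1) (J : ℕ) {n : ℕ} (h : n < 2 * J) :
    ∑ j ∈ Finset.range J, evenSummand a p e n j = evenBeta a p e n := by
  have ha₀ : a ≠ 1 := by simpa using ha 0
  induction n with
  | zero =>
    rw [Finset.sum_eq_single_of_mem 0 (Finset.mem_range.mpr (by lia))
      fun j _ hj => evenSummand_of_lt (by lia), evenSummand, evenAlpha_zero p e ha₀, evenBeta_zero]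
    simp [qPoch_zero, invQPochSub]
  | succ n ih =>
    have h₁ : 1 - a * p * (p ^ n) ^ 2 ≠ 0 := by
      rw [← pow_mul, mul_assoc, ← pow_succ']
      exact sub_ne_zero.mpr (ha _).symm
    have h₂ : 1 - a * p * e * p ^ n ≠ 0 := sub_ne_zero.mpr (he n).symm
    have h₃ : 1 - p * p ^ n ≠ 0 := by
      rw [← pow_succ']
      exact one_sub_ne_zero_of_norm_lt_one (norm_pow_succ_lt_one hp n)
    have certificate_zero : evenCertificate a p e n 0 = 0 := by simp [evenCertificate]
    have certificate_last : evenCertificate a p e n J = 0 := by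
      rw [evenCertificate, invQPochSub_of_lt h, zero_mul, mul_zero]
    have recurrence : (1 - a * p * (p ^ n) ^ 2) * (1 - a * p * e * p ^ n) * (1 - p * p ^ n) *
        ∑ j ∈ Finset.range J, evenSummand a p e (n + 1) j =
          (1 - a * p * e * (p ^ n) ^ 2) * evenBeta a p e n := by
      rw [Finset.mul_sum, Finset.sum_congr rfl fun j _ => evenSummand_step hp₀ hp ha he n j,
        Finset.sum_add_distrib, Finset.sum_range_sub, ← Finset.mul_sum, ih (by lia),
        certificate_zero, certificate_last, sub_zero, add_zero]
    rw [← evenBeta_succ, div_mul_eq_mul_div, eq_div_iff (mul_ne_zero (mul_ne_zero h₁ h₂) h₃),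
      mul_comm, recurrence]

theorem isBaileyPair_even (hp₀ : p ≠ 0) (hp : ‖p‖ < 1) (ha : ∀ k : ℕ, a * p ^ k ≠ 1)
    (he : ∀ k : ℕ, a * p * e * p ^ k ≠ 1) :
    IsBaileyPair a p (Function.extend (2 * ·) (evenAlpha a p e) 0) (evenBeta a p e) where
  alpha_zero := ((mul_right_injective₀ two_ne_zero).extend_apply _ _ 0).trans
    (evenAlpha_zero p e (by simpa using ha 0))
  beta_zero := evenBeta_zero a p e
  beta_eq n _ := by
    rw [← sum_evenSummand hp₀ hp ha he (n / 2 + 1) (by lia)]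
    refine Finset.sum_of_injOn (2 * ·) (mul_right_injective₀ two_ne_zero).injOn
      (fun j hj => ?_) (fun i _ hi => ?_) fun j hj => ?_
    · simp only [Finset.coe_range, Set.mem_Iio] at hj ⊢
      lia
    · rw [Function.extend_apply', Pi.zero_apply, zero_div]
      rintro ⟨j, rfl⟩
      refine hi ⟨j, ?_, rfl⟩
      simp only [Finset.coe_range, Set.mem_Iio, Finset.mem_range] at *
      lia
    · have hj' : 2 * j ≤ n := by
        have := Finset.mem_range.mp hj
        lia
      rw [(mul_right_injective₀ two_ne_zero).extend_apply, evenSummand, invQPochSub, if_pos hj',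
        div_eq_mul_inv, div_eq_mul_inv, mul_inv]

theorem exists_norm_evenWeight_le (hp : ‖p‖ < 1) (he : ∀ k : ℕ, a * p * e * p ^ k ≠ 1) :
    ∃ C : ℝ, ∀ n, ‖evenWeight a p e n‖ ≤ C * ((‖a‖ * (‖e‖ + 1)) ^ n * ‖p‖ ^ n.choose 2) := by
  have hp₂ := norm_pow_succ_lt_one hp 1
  obtain ⟨C₁, hC₁⟩ := exists_norm_inv_qPoch_le hp₂ (mul_pow_ne_one hp₂ hp₂.le)
  obtain ⟨C₂, hC₂⟩ := exists_norm_inv_qPoch_le (a := a * p ^ 2 * e) hp₂ fun k => by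
    convert he (2 * k + 1) using 1
    ring
  have hC₁₀ : 0 ≤ C₁ := (norm_nonneg _).trans (hC₁ 0)
  refine ⟨Real.exp (‖a‖ / (1 - ‖p ^ 2‖)) * (C₁ * C₂), fun n => ?_⟩
  have prod_le : ‖∏ i ∈ Finset.range n, (e - (p ^ 2) ^ i)‖ ≤ (‖e‖ + 1) ^ n := by
    rw [norm_prod]
    refine (Finset.prod_le_prod (g := fun _ => ‖e‖ + 1) (fun i _ => norm_nonneg _)
      fun i _ => (norm_sub_le _ _).trans ?_).trans_eq (by simp)
    gcongr
    rw [norm_pow]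
    exact pow_le_one₀ (norm_nonneg _) hp₂.le
  have hp_pow : ‖p‖ ^ (2 * n ^ 2) ≤ ‖p‖ ^ n.choose 2 :=
    pow_le_pow_of_le_one (norm_nonneg p) hp.le
      ((Nat.choose_le_pow n 2).trans (Nat.le_mul_of_pos_left _ two_pos))
  calc ‖evenWeight a p e n‖
      = ‖qPoch a (p ^ 2) n‖ * ‖∏ i ∈ Finset.range n, (e - (p ^ 2) ^ i)‖ *
          (‖a‖ ^ n * ‖p‖ ^ (2 * n ^ 2)) *
          (‖(qPoch (p ^ 2) (p ^ 2) n)⁻¹‖ * ‖(qPoch (a * p ^ 2 * e) (p ^ 2) n)⁻¹‖) := by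
        rw [evenWeight, div_eq_mul_inv, mul_inv]
        simp only [norm_mul, norm_pow]
    _ ≤ Real.exp (‖a‖ / (1 - ‖p ^ 2‖)) * (‖e‖ + 1) ^ n * (‖a‖ ^ n * ‖p‖ ^ n.choose 2) *
          (C₁ * C₂) := by
        gcongr ?_ * ?_ * (_ * ?_) * (?_ * ?_)
        · exact norm_qPoch_le le_rfl hp₂ n
        · exact hC₁ n
        · exact hC₂ n
    _ = _ := by
        rw [mul_pow]
        ring

theorem summable_evenAlpha (hp : ‖p‖ < 1) (hc : ‖c‖ < 1) (he : ∀ k : ℕ, a * p * e * p ^ k ≠ 1) :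
    Summable fun n => qPoch (p ^ 2) (p ^ 2) (2 * n - 1) * (-c) ^ (2 * n) /
      qPoch (c ^ 2) (p ^ 2) (2 * n) * evenAlpha a p e n := by
  have hp₂ := norm_pow_succ_lt_one hp 1
  have hc₂ := norm_pow_succ_lt_one hc 1
  obtain ⟨C, hC⟩ := exists_norm_inv_qPoch_le hp₂ (mul_pow_ne_one hc₂ hp₂.le)
  have hC₀ : 0 ≤ C := (norm_nonneg _).trans (hC 0)
  obtain ⟨K, hK⟩ := exists_norm_evenWeight_le (a := a) hp he
  have hsum := (summable_pow_mul_pow_choose_two hp ((‖a‖ * (‖e‖ + 1) : ℝ) : ℂ)).norm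
  simp only [norm_mul, norm_pow, Complex.norm_real,
    Real.norm_of_nonneg (by positivity : 0 ≤ ‖a‖ * (‖e‖ + 1))] at hsum
  refine Summable.of_norm_bounded (hsum.mul_left
      (Real.exp (1 / (1 - ‖p ^ 2‖)) * 1 * C * ((1 + ‖a‖) * ‖(1 - a)⁻¹‖ * K))) fun n => ?_
  have pow_le : ‖(-c) ^ (2 * n)‖ ≤ 1 := by
    rw [norm_pow, norm_neg]
    exact pow_le_one₀ (norm_nonneg c) hc.le
  have factor_le : ‖1 - a * p ^ (4 * n)‖ ≤ 1 + ‖a‖ := by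
    refine (norm_sub_le _ _).trans ?_
    rw [norm_one]
    gcongr
    exact norm_mul_pow_le hp.le a _
  calc ‖qPoch (p ^ 2) (p ^ 2) (2 * n - 1) * (-c) ^ (2 * n) / qPoch (c ^ 2) (p ^ 2) (2 * n) *
        evenAlpha a p e n‖
      = ‖qPoch (p ^ 2) (p ^ 2) (2 * n - 1)‖ * ‖(-c) ^ (2 * n)‖ *
          ‖(qPoch (c ^ 2) (p ^ 2) (2 * n))⁻¹‖ *
          (‖1 - a * p ^ (4 * n)‖ * ‖(1 - a)⁻¹‖ * ‖evenWeight a p e n‖) := by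
        rw [evenAlpha, div_eq_mul_inv, div_eq_mul_inv]
        simp only [norm_mul]
    _ ≤ Real.exp (1 / (1 - ‖p ^ 2‖)) * 1 * C * ((1 + ‖a‖) * ‖(1 - a)⁻¹‖ *
          (K * ((‖a‖ * (‖e‖ + 1)) ^ n * ‖p‖ ^ n.choose 2))) := by
        gcongr ?_ * ?_ * ?_ * (?_ * _ * ?_)
        · exact norm_qPoch_le hp₂.le hp₂ _
        · exact hC _
        · exact hK n
    _ = _ := by ring

theorem exists_seriesSum_even (hp₀ : p ≠ 0) (hp : ‖p‖ < 1) (hac : a * p = c) (hc : ‖c‖ < 1)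
    (ha : ∀ k : ℕ, a * p ^ k ≠ 1) (he : ∀ k : ℕ, a * p * e * p ^ k ≠ 1) :
    ∃ A : ℂ, SeriesSum (fun n => qPoch (p ^ 2) (p ^ 2) (2 * n - 1) * (-c) ^ (2 * n) /
        qPoch (c ^ 2) (p ^ 2) (2 * n) * evenAlpha a p e n) A ∧
      SeriesSum (fun n => qPoch (p ^ 2) (p ^ 2) (n - 1) * (-c) ^ n * evenBeta a p e n)
        (A + ∑' n, lambertTerm p c n) := by
  have hA := ((summable_nat_add_iff 1).mpr (summable_evenAlpha hp hc he)).hasSum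
  refine ⟨_, seriesSum_of_hasSum hA, (isBaileyPair_even hp₀ hp ha he).seriesSum hp hac hc
    (seriesSum_of_hasSum ?_)⟩
  have hinj : Function.Injective fun n : ℕ => 2 * n + 1 := fun m n h => by
    simp only at h
    lia
  refine (hinj.hasSum_iff fun i hi => ?_).mp ?_
  · rw [Function.extend_apply', Pi.zero_apply, mul_zero]
    rintro ⟨j, hj⟩
    exact hi ⟨j - 1, by simp only at hj ⊢; lia⟩
  · simpa only [Function.comp_def, add_assoc, one_add_one_eq_two, ← mul_add_one 2,
      (mul_right_injective₀ (two_ne_zero (α := ℕ))).extend_apply] using hA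

end EvenPair

section Expansions

variable {q : ℂ}

theorem pow_injective_of_norm_lt_one (hq₀ : q ≠ 0) (hq : ‖q‖ < 1) :
    Function.Injective fun n : ℕ => q ^ n := fun m n h =>
  pow_right_injective₀ (norm_pos_iff.mpr hq₀) hq.ne (by simpa using congrArg norm h)

theorem one_div_pow_mul_pow_ne_one (hq₀ : q ≠ 0) (hq : ‖q‖ < 1) {b : ℕ} (hb : ¬ 3 ∣ b) (k : ℕ) :
    1 / q ^ b * (q ^ 3) ^ k ≠ 1 := by
  intro h
  rw [one_div, inv_mul_eq_one₀ (pow_ne_zero b hq₀), ← pow_mul] at h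
  exact hb ⟨k, pow_injective_of_norm_lt_one hq₀ hq h⟩

theorem explicit_expansion_quadratic (hq : ‖q‖ < 1) :
    ∃ S T : ℂ,
      SeriesSum (fun n => (1 - q ^ (6 * n - 2)) * qPoch (-q ^ 3) (q ^ 3) (n - 1)
        * q ^ ((3 * n ^ 2 - n) / 2)
        / ((1 - q ^ (3 * n - 2)) * (1 - q ^ (3 * n)) * qPoch (-q) (q ^ 3) n)) S ∧
      SeriesSum (fun n => (1 - q ^ (6 * n - 1)) * qPoch (-q ^ 3) (q ^ 3) (n - 1)
        * q ^ ((3 * n ^ 2 + n) / 2)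
        / ((1 - q ^ (3 * n - 1)) * (1 - q ^ (3 * n)) * qPoch (-q ^ 2) (q ^ 3) n)) T ∧
      q * (ramanujanPsi (q ^ 3) ^ 3 / ramanujanPsi q) = S - T := by
  have hp : ‖q ^ 3‖ < 1 := norm_pow_succ_lt_one hq 2
  have hq₂ : ‖q ^ 2‖ < 1 := norm_pow_succ_lt_one hq 1
  have triangular (n : ℕ) : 2 * (n + 1).choose 2 = n * (n + 1) := by
    rw [choose_two_eq_half, Nat.mul_div_cancel' (Nat.even_mul_succ_self n).two_dvd]
  refine ⟨_, _, seriesSum_of_hasSum ((summable_quadraticLambertTerm hp hq).hasSum.congr_fun ?_),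
    seriesSum_of_hasSum ((summable_quadraticLambertTerm hp hq₂).hasSum.congr_fun ?_), ?_⟩
  · intro n
    have exponent : (3 * (n + 1) ^ 2 - (n + 1)) / 2 = n + 1 + 3 * (n + 1).choose 2 := by
      have := triangular n
      lia
    rw [quadraticLambertTerm, exponent, show 6 * (n + 1) - 2 = 1 + 3 * (2 * n + 1) by lia,
      show 3 * (n + 1) - 2 = 1 + 3 * n by lia, Nat.add_sub_cancel]
    ring
  · intro n
    have exponent : (3 * (n + 1) ^ 2 + (n + 1)) / 2 = 2 * (n + 1) + 3 * (n + 1).choose 2 := by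
      have := triangular n
      lia
    rw [quadraticLambertTerm, exponent, show 6 * (n + 1) - 1 = 2 + 3 * (2 * n + 1) by lia,
      show 3 * (n + 1) - 1 = 2 + 3 * n by lia, Nat.add_sub_cancel]
    ring
  · rw [tsum_quadraticLambertTerm hp hq, tsum_quadraticLambertTerm hp hq₂,
      ← tsum_lambertTerm_sub hq, neg_sub_neg]

theorem lambertTerm_eq {p : ℂ} (hp : ‖p‖ < 1) (c : ℂ) (n : ℕ) :
    lambertTerm p c n =
      qPoch (-p) p n * (-c) ^ (n + 1) / ((1 - p ^ (n + 1)) * qPoch c p (n + 1)) := by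
  rw [lambertTerm, ← qPoch_mul_qPoch_neg, qPoch_succ p, ← pow_succ', mul_assoc, mul_assoc,
    mul_div_mul_left _ _ (qPoch_self_ne_zero hp n)]

theorem explicit_expansion_alternating (hq : ‖q‖ < 1) :
    ∃ S T : ℂ,
      SeriesSum (fun n => qPoch (-q ^ 3) (q ^ 3) (n - 1) * (-1) ^ n * q ^ (2 * n)
        / ((1 - q ^ (3 * n)) * qPoch (q ^ 2) (q ^ 3) n)) S ∧
      SeriesSum (fun n => qPoch (-q ^ 3) (q ^ 3) (n - 1) * (-1) ^ n * q ^ n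
        / ((1 - q ^ (3 * n)) * qPoch q (q ^ 3) n)) T ∧
      q * (ramanujanPsi (q ^ 3) ^ 3 / ramanujanPsi q) = S - T := by
  have hp : ‖q ^ 3‖ < 1 := norm_pow_succ_lt_one hq 2
  have hq₂ : ‖q ^ 2‖ < 1 := norm_pow_succ_lt_one hq 1
  refine ⟨_, _, seriesSum_of_hasSum ((summable_lambertTerm hp hq₂).hasSum.congr_fun ?_),
    seriesSum_of_hasSum ((summable_lambertTerm hp hq).hasSum.congr_fun ?_),
    (tsum_lambertTerm_sub hq).symm⟩
  · intro n
    rw [lambertTerm_eq hp, Nat.add_sub_cancel, ← pow_mul q 3, neg_pow (q ^ 2), ← pow_mul q 2]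
    ring
  · intro n
    rw [lambertTerm_eq hp, Nat.add_sub_cancel, ← pow_mul q 3, neg_pow q]
    ring

theorem baileyPair_expansion (hq : ‖q‖ < 1) (hq₀ : q ≠ 0) {α₁ β₁ α₂ β₂ : ℕ → ℂ}
    (h₁ : IsBaileyPair (1 / q) (q ^ 3) α₁ β₁) (h₂ : IsBaileyPair (1 / q ^ 2) (q ^ 3) α₂ β₂)
    {A₁ A₂ : ℂ}
    (hA₁ : SeriesSum (fun n => qPoch (q ^ 6) (q ^ 6) (n - 1) * (-q) ^ n
      / qPoch (q ^ 2) (q ^ 6) n * α₂ n) A₁)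
    (hA₂ : SeriesSum (fun n => qPoch (q ^ 6) (q ^ 6) (n - 1) * (-q ^ 2) ^ n
      / qPoch (q ^ 4) (q ^ 6) n * α₁ n) A₂) :
    ∃ B₁ B₂ : ℂ,
      SeriesSum (fun n => qPoch (q ^ 6) (q ^ 6) (n - 1) * (-q ^ 2) ^ n * β₁ n) B₁ ∧
      SeriesSum (fun n => qPoch (q ^ 6) (q ^ 6) (n - 1) * (-q) ^ n * β₂ n) B₂ ∧
      q * (ramanujanPsi (q ^ 3) ^ 3 / ramanujanPsi q) = B₁ - B₂ + A₁ - A₂ := by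
  have hp : ‖q ^ 3‖ < 1 := norm_pow_succ_lt_one hq 2
  have hB₁ := h₁.seriesSum (c := q ^ 2) (A := A₂) hp (by field_simp) (norm_pow_succ_lt_one hq 1)
    (by rwa [pow_three_pow_two, ← pow_mul q 2 2])
  have hB₂ := h₂.seriesSum (c := q) (A := A₁) hp (by field_simp) hq (by rwa [pow_three_pow_two])
  rw [pow_three_pow_two] at hB₁ hB₂
  refine ⟨_, _, hB₁, hB₂, ?_⟩
  rw [← tsum_lambertTerm_sub hq]
  ring

theorem evenBeta_term {a c : ℂ} (hac : a * q ^ 3 = c) (e : ℂ) (n : ℕ) :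
    qPoch (q ^ 6) (q ^ 6) (n - 1) * (-c) ^ n * evenBeta a (q ^ 3) e n =
      qPoch (q ^ 6) (q ^ 6) (n - 1) * qPoch (c * e) (q ^ 6) n * (-c) ^ n /
        (qPoch c (q ^ 6) n * (qPoch (c * e) (q ^ 3) n * qPoch (q ^ 3) (q ^ 3) n)) := by
  rw [evenBeta, hac, pow_three_pow_two]
  ring

theorem evenAlpha_term (a c e : ℂ) (n : ℕ) :
    qPoch (q ^ 6) (q ^ 6) (2 * n - 1) * (-c) ^ (2 * n) / qPoch (c ^ 2) (q ^ 6) (2 * n) *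
        evenAlpha a (q ^ 3) e n =
      (1 - a * q ^ (12 * n)) * qPoch (q ^ 6) (q ^ 6) (2 * n - 1) *
        (qPoch a (q ^ 6) n * ∏ i ∈ Finset.range n, (e - (q ^ 6) ^ i)) *
        ((c ^ 2 * a) ^ n * q ^ (6 * n ^ 2)) /
        ((1 - a) * qPoch (c ^ 2) (q ^ 6) (2 * n) *
          (qPoch (a * q ^ 6 * e) (q ^ 6) n * qPoch (q ^ 6) (q ^ 6) n)) := by
  rw [evenAlpha, evenWeight, pow_three_pow_two, ← pow_mul q, ← pow_mul q, mul_pow, ← pow_mul c,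
    (even_two_mul n).neg_pow, show 3 * (4 * n) = 12 * n by ring,
    show 3 * (2 * n ^ 2) = 6 * n ^ 2 by ring]
  simp only [div_eq_mul_inv, mul_inv]
  ring

theorem freeParameter_expansion (hq : ‖q‖ < 1) (hq₀ : q ≠ 0) {e : ℂ}
    (he : ∀ n : ℕ, q ^ (3 * n + 1) * e ≠ 1 ∧ q ^ (3 * n + 2) * e ≠ 1) :
    ∃ S₁ S₂ S₃ S₄ : ℂ,
      SeriesSum (fun n => qPoch (q ^ 6) (q ^ 6) (n - 1) * qPoch (q ^ 2 * e) (q ^ 6) n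
        * (-q ^ 2) ^ n
        / (qPoch (q ^ 2) (q ^ 6) n
          * (qPoch (q ^ 2 * e) (q ^ 3) n * qPoch (q ^ 3) (q ^ 3) n))) S₁ ∧
      SeriesSum (fun n => qPoch (q ^ 6) (q ^ 6) (n - 1) * qPoch (q * e) (q ^ 6) n
        * (-q) ^ n
        / (qPoch q (q ^ 6) n
          * (qPoch (q * e) (q ^ 3) n * qPoch (q ^ 3) (q ^ 3) n))) S₂ ∧
      SeriesSum (fun n => (1 - q ^ (12 * n - 2)) * qPoch (q ^ 6) (q ^ 6) (2 * n - 1)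
        * (qPoch (1 / q ^ 2) (q ^ 6) n * ∏ i ∈ Finset.range n, (e - (q ^ 6) ^ i))
        * q ^ (6 * n ^ 2)
        / ((1 - 1 / q ^ 2) * qPoch (q ^ 2) (q ^ 6) (2 * n)
          * (qPoch (q ^ 4 * e) (q ^ 6) n * qPoch (q ^ 6) (q ^ 6) n))) S₃ ∧
      SeriesSum (fun n => (1 - q ^ (12 * n - 1)) * qPoch (q ^ 6) (q ^ 6) (2 * n - 1)
        * (qPoch (1 / q) (q ^ 6) n * ∏ i ∈ Finset.range n, (e - (q ^ 6) ^ i))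
        * q ^ (6 * n ^ 2 + 3 * n)
        / ((1 - 1 / q) * qPoch (q ^ 4) (q ^ 6) (2 * n)
          * (qPoch (q ^ 5 * e) (q ^ 6) n * qPoch (q ^ 6) (q ^ 6) n))) S₄ ∧
      q * (ramanujanPsi (q ^ 3) ^ 3 / ramanujanPsi q) = S₁ - S₂ + S₃ - S₄ := by
  have hp : ‖q ^ 3‖ < 1 := norm_pow_succ_lt_one hq 2
  have hp₀ : q ^ 3 ≠ 0 := pow_ne_zero 3 hq₀
  have hac₁ : 1 / q * q ^ 3 = q ^ 2 := by field_simp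
  have hac₂ : 1 / q ^ 2 * q ^ 3 = q := by field_simp
  obtain ⟨A₄, hA₄, hB₁⟩ := exists_seriesSum_even (e := e) hp₀ hp hac₁ (norm_pow_succ_lt_one hq 1)
    (by simpa using one_div_pow_mul_pow_ne_one hq₀ hq (b := 1) (by simp))
    (fun k => by
      rw [hac₁, mul_right_comm, ← pow_mul, ← pow_add, add_comm]
      exact (he k).2)
  obtain ⟨A₃, hA₃, hB₂⟩ := exists_seriesSum_even (e := e) hp₀ hp hac₂ hq
    (one_div_pow_mul_pow_ne_one hq₀ hq (by simp))
    (fun k => by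
      rw [hac₂, mul_right_comm, ← pow_mul, ← pow_succ']
      exact (he k).1)
  simp only [pow_three_pow_two, evenBeta_term hac₁, evenBeta_term hac₂, evenAlpha_term]
    at hA₃ hA₄ hB₁ hB₂
  refine ⟨_, _, A₃, A₄, hB₁, hB₂, hA₃.congr fun n => ?_, hA₄.congr fun n => ?_, ?_⟩
  · have shift : 1 / q ^ 2 * q ^ (12 * (n + 1)) = q ^ (12 * (n + 1) - 2) := by
      rw [pow_sub₀ q hq₀ (by lia), one_div, mul_comm]
    rw [shift, mul_one_div_cancel (pow_ne_zero 2 hq₀), one_pow, one_mul,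
      show 1 / q ^ 2 * q ^ 6 = q ^ 4 by field_simp]
  · have shift : 1 / q * q ^ (12 * (n + 1)) = q ^ (12 * (n + 1) - 1) := by
      rw [pow_sub₀ q hq₀ (by lia), pow_one, one_div, mul_comm]
    rw [shift, show (q ^ 2) ^ 2 * (1 / q) = q ^ 3 by field_simp, ← pow_mul q 2 2, ← pow_mul q 3,
      ← pow_add, add_comm (3 * _), show 1 / q * q ^ 6 = q ^ 5 by field_simp]
  · rw [← tsum_lambertTerm_sub hq]
    ring

theorem prod_one_div_sub_pow {d : ℂ} (hd : d ≠ 0) (p : ℂ) (n : ℕ) :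
    ∏ i ∈ Finset.range n, (1 / d - p ^ i) = qPoch d p n / d ^ n := by
  rw [qPoch, ← Finset.card_range n, ← Finset.prod_const, Finset.card_range,
    ← Finset.prod_div_distrib]
  refine Finset.prod_congr rfl fun i _ => ?_
  field_simp

theorem prod_zero_sub_pow (q : ℂ) (n : ℕ) :
    ∏ i ∈ Finset.range n, (0 - (q ^ 6) ^ i) = (-1) ^ n * q ^ (3 * n ^ 2 - 3 * n) := by
  induction n with
  | zero => simp
  | succ n ih =>
    have exponent : 3 * (n + 1) ^ 2 - 3 * (n + 1) = 3 * n ^ 2 - 3 * n + 6 * n := by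
      have : n ≤ n ^ 2 := Nat.le_self_pow two_ne_zero n
      lia
    rw [Finset.prod_range_succ, ih, exponent]
    ring

theorem qPoch_zero_left (p : ℂ) (n : ℕ) : qPoch 0 p n = 1 := by simp [qPoch]

theorem parametric_expansion (hq : ‖q‖ < 1) (hq₀ : q ≠ 0) {d : ℂ} (hd : d ≠ 0)
    (hdq : ∀ n : ℕ, d ≠ q ^ (3 * n + 1) ∧ d ≠ q ^ (3 * n + 2)) :
    ∃ S₁ S₂ S₃ S₄ : ℂ,
      SeriesSum (fun n => qPoch (q ^ 6) (q ^ 6) (n - 1) * qPoch (q ^ 2 / d) (q ^ 6) n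
        * (-q ^ 2) ^ n
        / (qPoch (q ^ 2) (q ^ 6) n
          * (qPoch (q ^ 2 / d) (q ^ 3) n * qPoch (q ^ 3) (q ^ 3) n))) S₁ ∧
      SeriesSum (fun n => qPoch (q ^ 6) (q ^ 6) (n - 1) * qPoch (q / d) (q ^ 6) n
        * (-q) ^ n
        / (qPoch q (q ^ 6) n
          * (qPoch (q / d) (q ^ 3) n * qPoch (q ^ 3) (q ^ 3) n))) S₂ ∧
      SeriesSum (fun n => (1 - q ^ (12 * n - 2)) * qPoch (q ^ 6) (q ^ 6) (2 * n - 1)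
        * (qPoch (1 / q ^ 2) (q ^ 6) n * qPoch d (q ^ 6) n) * q ^ (6 * n ^ 2)
        / ((1 - 1 / q ^ 2) * qPoch (q ^ 2) (q ^ 6) (2 * n)
          * (qPoch (q ^ 4 / d) (q ^ 6) n * qPoch (q ^ 6) (q ^ 6) n) * d ^ n)) S₃ ∧
      SeriesSum (fun n => (1 - q ^ (12 * n - 1)) * qPoch (q ^ 6) (q ^ 6) (2 * n - 1)
        * (qPoch (1 / q) (q ^ 6) n * qPoch d (q ^ 6) n) * q ^ (6 * n ^ 2 + 3 * n)
        / ((1 - 1 / q) * qPoch (q ^ 4) (q ^ 6) (2 * n)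
          * (qPoch (q ^ 5 / d) (q ^ 6) n * qPoch (q ^ 6) (q ^ 6) n) * d ^ n)) S₄ ∧
      q * (ramanujanPsi (q ^ 3) ^ 3 / ramanujanPsi q) = S₁ - S₂ + S₃ - S₄ := by
  have expansion := freeParameter_expansion hq hq₀ (e := 1 / d) fun n => by
    simp only [mul_one_div, ne_eq, div_eq_one_iff_eq hd]
    exact ⟨(hdq n).1.symm, (hdq n).2.symm⟩
  have move_pow (x y z w : ℂ) (n : ℕ) : x * (y * (z / d ^ n)) * w = x * (y * z) * w / d ^ n := by
    ring
  simpa only [prod_one_div_sub_pow hd, mul_one_div, move_pow, div_div, mul_comm (d ^ _)]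
    using expansion

theorem limiting_expansion (hq : ‖q‖ < 1) (hq₀ : q ≠ 0) :
    ∃ S₁ S₂ S₃ S₄ : ℂ,
      SeriesSum (fun n => qPoch (q ^ 6) (q ^ 6) (n - 1) * (-q ^ 2) ^ n
        / (qPoch (q ^ 2) (q ^ 6) n * qPoch (q ^ 3) (q ^ 3) n)) S₁ ∧
      SeriesSum (fun n => qPoch (q ^ 6) (q ^ 6) (n - 1) * (-q) ^ n
        / (qPoch q (q ^ 6) n * qPoch (q ^ 3) (q ^ 3) n)) S₂ ∧
      SeriesSum (fun n => (1 - q ^ (12 * n - 2)) * qPoch (q ^ 6) (q ^ 6) (2 * n - 1)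
        * qPoch (1 / q ^ 2) (q ^ 6) n * (-1) ^ n * q ^ (9 * n ^ 2 - 3 * n)
        / ((1 - 1 / q ^ 2) * qPoch (q ^ 2) (q ^ 6) (2 * n) * qPoch (q ^ 6) (q ^ 6) n)) S₃ ∧
      SeriesSum (fun n => (1 - q ^ (12 * n - 1)) * qPoch (q ^ 6) (q ^ 6) (2 * n - 1)
        * qPoch (1 / q) (q ^ 6) n * (-1) ^ n * q ^ (9 * n ^ 2)
        / ((1 - 1 / q) * qPoch (q ^ 4) (q ^ 6) (2 * n) * qPoch (q ^ 6) (q ^ 6) n)) S₄ ∧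
      q * (ramanujanPsi (q ^ 3) ^ 3 / ramanujanPsi q) = S₁ - S₂ + S₃ - S₄ := by
  have le_sq (n : ℕ) : n ≤ n ^ 2 := Nat.le_self_pow two_ne_zero n
  have exponent₃ (n : ℕ) : 3 * n ^ 2 - 3 * n + 6 * n ^ 2 = 9 * n ^ 2 - 3 * n := by
    have := le_sq n
    lia
  have exponent₄ (n : ℕ) : 3 * n ^ 2 - 3 * n + (6 * n ^ 2 + 3 * n) = 9 * n ^ 2 := by
    have := le_sq n
    lia
  have expansion := freeParameter_expansion hq hq₀ (e := 0) (by simp)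
  simpa only [prod_zero_sub_pow, mul_zero, qPoch_zero_left, mul_one, one_mul, mul_assoc, ← pow_add,
    exponent₃, exponent₄] using expansion

end Expansions

theorem mainTheorem11 (q : ℂ) (hq : ‖q‖ < 1) :
    -- the two explicit `q`-series
    (∃ S T : ℂ,
      SeriesSum (fun n => (1 - q ^ (6 * n - 2)) * qPoch (-q ^ 3) (q ^ 3) (n - 1)
        * q ^ ((3 * n ^ 2 - n) / 2)
        / ((1 - q ^ (3 * n - 2)) * (1 - q ^ (3 * n)) * qPoch (-q) (q ^ 3) n)) S ∧
      SeriesSum (fun n => (1 - q ^ (6 * n - 1)) * qPoch (-q ^ 3) (q ^ 3) (n - 1)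
        * q ^ ((3 * n ^ 2 + n) / 2)
        / ((1 - q ^ (3 * n - 1)) * (1 - q ^ (3 * n)) * qPoch (-q ^ 2) (q ^ 3) n)) T ∧
      q * (ramanujanPsi (q ^ 3) ^ 3 / ramanujanPsi q) = S - T) ∧
    (∃ S T : ℂ,
      SeriesSum (fun n => qPoch (-q ^ 3) (q ^ 3) (n - 1) * (-1) ^ n * q ^ (2 * n)
        / ((1 - q ^ (3 * n)) * qPoch (q ^ 2) (q ^ 3) n)) S ∧
      SeriesSum (fun n => qPoch (-q ^ 3) (q ^ 3) (n - 1) * (-1) ^ n * q ^ n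
        / ((1 - q ^ (3 * n)) * qPoch q (q ^ 3) n)) T ∧
      q * (ramanujanPsi (q ^ 3) ^ 3 / ramanujanPsi q) = S - T) ∧
    -- the expansion in terms of an arbitrary Bailey pair `(α_n(a, Q), β_n(a, Q))`
    (q ≠ 0 → ∀ α β : ℂ → ℂ → ℕ → ℂ,
      IsBaileyPair (1 / q) (q ^ 3) (α (1 / q) (q ^ 3)) (β (1 / q) (q ^ 3)) →
      IsBaileyPair (1 / q ^ 2) (q ^ 3) (α (1 / q ^ 2) (q ^ 3)) (β (1 / q ^ 2) (q ^ 3)) →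
      ∀ A₁ A₂ : ℂ,
        SeriesSum (fun n => qPoch (q ^ 6) (q ^ 6) (n - 1) * (-q) ^ n
          / qPoch (q ^ 2) (q ^ 6) n * α (1 / q ^ 2) (q ^ 3) n) A₁ →
        SeriesSum (fun n => qPoch (q ^ 6) (q ^ 6) (n - 1) * (-q ^ 2) ^ n
          / qPoch (q ^ 4) (q ^ 6) n * α (1 / q) (q ^ 3) n) A₂ →
        ∃ B₁ B₂ : ℂ,
          SeriesSum (fun n => qPoch (q ^ 6) (q ^ 6) (n - 1) * (-q ^ 2) ^ n
            * β (1 / q) (q ^ 3) n) B₁ ∧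
          SeriesSum (fun n => qPoch (q ^ 6) (q ^ 6) (n - 1) * (-q) ^ n
            * β (1 / q ^ 2) (q ^ 3) n) B₂ ∧
          q * (ramanujanPsi (q ^ 3) ^ 3 / ramanujanPsi q) = B₁ - B₂ + A₁ - A₂) ∧
    -- the expansion with a free parameter `d`
    (q ≠ 0 → ∀ d : ℂ, d ≠ 0 → (∀ n : ℕ, d ≠ q ^ (3 * n + 1) ∧ d ≠ q ^ (3 * n + 2)) →
      ∃ S₁ S₂ S₃ S₄ : ℂ,
        SeriesSum (fun n => qPoch (q ^ 6) (q ^ 6) (n - 1) * qPoch (q ^ 2 / d) (q ^ 6) n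
          * (-q ^ 2) ^ n
          / (qPoch (q ^ 2) (q ^ 6) n
            * (qPoch (q ^ 2 / d) (q ^ 3) n * qPoch (q ^ 3) (q ^ 3) n))) S₁ ∧
        SeriesSum (fun n => qPoch (q ^ 6) (q ^ 6) (n - 1) * qPoch (q / d) (q ^ 6) n
          * (-q) ^ n
          / (qPoch q (q ^ 6) n
            * (qPoch (q / d) (q ^ 3) n * qPoch (q ^ 3) (q ^ 3) n))) S₂ ∧
        SeriesSum (fun n => (1 - q ^ (12 * n - 2)) * qPoch (q ^ 6) (q ^ 6) (2 * n - 1)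
          * (qPoch (1 / q ^ 2) (q ^ 6) n * qPoch d (q ^ 6) n) * q ^ (6 * n ^ 2)
          / ((1 - 1 / q ^ 2) * qPoch (q ^ 2) (q ^ 6) (2 * n)
            * (qPoch (q ^ 4 / d) (q ^ 6) n * qPoch (q ^ 6) (q ^ 6) n) * d ^ n)) S₃ ∧
        SeriesSum (fun n => (1 - q ^ (12 * n - 1)) * qPoch (q ^ 6) (q ^ 6) (2 * n - 1)
          * (qPoch (1 / q) (q ^ 6) n * qPoch d (q ^ 6) n) * q ^ (6 * n ^ 2 + 3 * n)
          / ((1 - 1 / q) * qPoch (q ^ 4) (q ^ 6) (2 * n)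
            * (qPoch (q ^ 5 / d) (q ^ 6) n * qPoch (q ^ 6) (q ^ 6) n) * d ^ n)) S₄ ∧
        q * (ramanujanPsi (q ^ 3) ^ 3 / ramanujanPsi q) = S₁ - S₂ + S₃ - S₄) ∧
    -- its limiting form as `d → ∞`
    (q ≠ 0 →
      ∃ S₁ S₂ S₃ S₄ : ℂ,
        SeriesSum (fun n => qPoch (q ^ 6) (q ^ 6) (n - 1) * (-q ^ 2) ^ n
          / (qPoch (q ^ 2) (q ^ 6) n * qPoch (q ^ 3) (q ^ 3) n)) S₁ ∧
        SeriesSum (fun n => qPoch (q ^ 6) (q ^ 6) (n - 1) * (-q) ^ n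
          / (qPoch q (q ^ 6) n * qPoch (q ^ 3) (q ^ 3) n)) S₂ ∧
        SeriesSum (fun n => (1 - q ^ (12 * n - 2)) * qPoch (q ^ 6) (q ^ 6) (2 * n - 1)
          * qPoch (1 / q ^ 2) (q ^ 6) n * (-1) ^ n * q ^ (9 * n ^ 2 - 3 * n)
          / ((1 - 1 / q ^ 2) * qPoch (q ^ 2) (q ^ 6) (2 * n) * qPoch (q ^ 6) (q ^ 6) n)) S₃ ∧
        SeriesSum (fun n => (1 - q ^ (12 * n - 1)) * qPoch (q ^ 6) (q ^ 6) (2 * n - 1)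
          * qPoch (1 / q) (q ^ 6) n * (-1) ^ n * q ^ (9 * n ^ 2)
          / ((1 - 1 / q) * qPoch (q ^ 4) (q ^ 6) (2 * n) * qPoch (q ^ 6) (q ^ 6) n)) S₄ ∧
        q * (ramanujanPsi (q ^ 3) ^ 3 / ramanujanPsi q) = S₁ - S₂ + S₃ - S₄) :=
  ⟨explicit_expansion_quadratic hq, explicit_expansion_alternating hq,
    fun hq₀ _ _ h₁ h₂ _ _ hA₁ hA₂ => baileyPair_expansion hq hq₀ h₁ h₂ hA₁ hA₂,
    fun hq₀ _ hd hdq => parametric_expansion hq hq₀ hd hdq,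
    fun hq₀ => limiting_expansion hq hq₀⟩
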